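/- Let $p$ be a prime and let $K/F$ be an unramified extension of degree $n$ of $p$-adic fields (finite extensions of $\mathbb{Q}_p$), with valuation rings $\mathcal{O}_K,\mathcal{O}_F$, and let $q$ be the size of the residue field of $F$. Let $\lambda_K$ be the Haar measure on $K$ normalized by $\lambda_K(\mathcal{O}_K)=1$, let $dx$ denote integration with respect to $\lambda_K$, and for $x\in\mathcal{O}_K$ put $\phi_{K/F}(x)=\lambda_K(\mathcal{O}_F[x])$. Define $D_m(u,v)$ for $m\ge 1$ recursively by $D_1(u,v)=1$ and, for $m>1$, $$D_m(u,v)=\frac{1}{u^{m-1}-v^{m-1}}\sum_{1\neq d\mid m} v^{m/d-1}\Bigl(\sum_{e\mid d}\mu\bigl(\tfrac{d}{e}\bigr)u^{e-1}\Bigr)D_{m/d}(u^d,v),$$ where $\mu$ is the Möbius function. Then for every $r\in\mathbb{C}$ with $\operatorname{Re} r>0$ the function $x\mapsto\phi_{K/F}(x)^r$ is integrable on $\mathcal{O}_K$ and $$\int_{\mathcal{O}_K}\phi_{K/F}(x)^r\,dx=D_n\bigl(q,q^{-nr/2}\bigr).$$ -/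

import Mathlib

open MeasureTheory

section PAdicFields

variable (p : ℕ) [Fact p.Prime]

/-- The norm of a `p`-adic field (one that extends the `p`-adic absolute value of `ℚ_[p]`) is
ultrametric. -/
theorem PAdicField.isUltrametricDist (E : Type*) [NormedField E] [NormedAlgebra ℚ_[p] E] :
    IsUltrametricDist E := by
  refine IsUltrametricDist.isUltrametricDist_of_forall_norm_natCast_le_one fun m => ?_
  have h : ‖algebraMap ℚ_[p] E (m : ℚ_[p])‖ = ‖(m : ℚ_[p])‖ := norm_algebraMap' E _
  rw [map_natCast] at h
  rw [h]
  exact IsUltrametricDist.norm_natCast_le_one ℚ_[p] m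

/-- The valuation ring `𝒪_E = {x : ‖x‖ ≤ 1}` of a `p`-adic field `E`. -/
noncomputable def PAdicField.integers (E : Type*) [NormedField E] [NormedAlgebra ℚ_[p] E] :
    ValuationSubring E :=
  haveI := PAdicField.isUltrametricDist p E
  (NormedField.valuation (K := E)).valuationSubring

theorem PAdicField.mem_integers {E : Type*} [NormedField E] [NormedAlgebra ℚ_[p] E] {x : E} :
    x ∈ PAdicField.integers p E ↔ ‖x‖ ≤ 1 :=
  Iff.rfl

/-- The residue field cardinality of a `p`-adic field. -/
noncomputable def PAdicField.residueCard (E : Type*) [NormedField E] [NormedAlgebra ℚ_[p] E] : ℕ :=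
  Nat.card (IsLocalRing.ResidueField (PAdicField.integers p E))

/-- The inclusion `𝒪_F → 𝒪_K` attached to an extension `K / F` of `p`-adic fields. -/
noncomputable def PAdicField.integersMap (F K : Type*) [NormedField F] [NormedAlgebra ℚ_[p] F]
    [NormedField K] [NormedAlgebra ℚ_[p] K] [NormedAlgebra F K] :
    PAdicField.integers p F →+* PAdicField.integers p K :=
  ((algebraMap F K).comp (PAdicField.integers p F).subtype).codRestrict
    (PAdicField.integers p K) fun x => by
      rw [PAdicField.mem_integers]
      exact (norm_algebraMap' K (x : F)).le.trans ((PAdicField.mem_integers p).1 x.2)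

/-- `K / F` is unramified: `𝔪_F 𝒪_K = 𝔪_K`, that is, a uniformizer of `F` is a uniformizer of `K`
(the residue fields are finite, so the residue extension is automatically separable). -/
def PAdicField.IsUnramified (F K : Type*) [NormedField F] [NormedAlgebra ℚ_[p] F]
    [NormedField K] [NormedAlgebra ℚ_[p] K] [NormedAlgebra F K] : Prop :=
  (IsLocalRing.maximalIdeal (PAdicField.integers p F)).map (PAdicField.integersMap p F K) =
    IsLocalRing.maximalIdeal (PAdicField.integers p K)

/-- The closed unit ball `𝒪_E` of a `p`-adic field as a compact set with nonempty interior. -/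
noncomputable def PAdicField.integersCompacts (E : Type*) [NormedField E] [NormedAlgebra ℚ_[p] E]
    [FiniteDimensional ℚ_[p] E] : TopologicalSpace.PositiveCompacts E where
  carrier := PAdicField.integers p E
  isCompact' := by
    have : ProperSpace E := FiniteDimensional.proper ℚ_[p] E
    have h : (PAdicField.integers p E : Set E) = Metric.closedBall 0 1 := by
      ext x
      simp [PAdicField.mem_integers]
    rw [h]
    exact isCompact_closedBall 0 1
  interior_nonempty' := by
    refine ⟨0, mem_interior_iff_mem_nhds.2 (Filter.mem_of_superset
      (Metric.closedBall_mem_nhds (0 : E) one_pos) fun x hx => ?_)⟩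
    simpa [PAdicField.mem_integers] using hx

/-- The Haar measure `λ_E` of a `p`-adic field, normalized by `λ_E(𝒪_E) = 1`. -/
noncomputable def PAdicField.haar (E : Type*) [NormedField E] [NormedAlgebra ℚ_[p] E]
    [FiniteDimensional ℚ_[p] E] [MeasurableSpace E] [BorelSpace E] : Measure E :=
  Measure.addHaarMeasure (PAdicField.integersCompacts p E)

/-- `φ_{K/F}(x) = λ_K(𝒪_F[x])`. It is used only for `x ∈ 𝒪_K`, where `𝒪_F[x] ⊆ 𝒪_K` has
measure at most `1`. -/
noncomputable def PAdicField.phi (F K : Type*) [NormedField F] [NormedAlgebra ℚ_[p] F]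
    [NormedField K] [NormedAlgebra ℚ_[p] K] [FiniteDimensional ℚ_[p] K] [NormedAlgebra F K]
    [MeasurableSpace K] [BorelSpace K] (x : K) : ℝ :=
  (PAdicField.haar p K).real (Algebra.adjoin (PAdicField.integers p F) {x} : Set K)

end PAdicFields

/-- The values of the rational functions `D_n(u, v)`: `D_1(u, v) = 1` and, for `n > 1`,
`D_n(u, v) = (u^(n-1) - v^(n-1))⁻¹ * ∑_{1 ≠ d ∣ n} v^(n/d-1) * (∑_{e ∣ d} μ(d/e) u^(e-1)) *
D_{n/d}(u^d, v)`. -/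
noncomputable def dFunction (n : ℕ) (u v : ℂ) : ℂ :=
  if n = 1 then 1
  else 1 / (u ^ (n - 1) - v ^ (n - 1)) *
    ∑ d : {d : ℕ // d ∈ n.divisors.erase 1},
      v ^ (n / d.1 - 1) *
        (∑ e ∈ d.1.divisors, (ArithmeticFunction.moebius (d.1 / e) : ℂ) * u ^ (e - 1)) *
        dFunction (n / d.1) (u ^ d.1) v
termination_by n
decreasing_by
  have hd := d.2
  rw [Finset.mem_erase, Nat.mem_divisors] at hd
  have hd0 : d.1 ≠ 0 := by
    intro h0
    rw [h0] at hd
    exact hd.2.2 (Nat.eq_zero_of_zero_dvd hd.2.1)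
  exact Nat.div_lt_self (Nat.pos_of_ne_zero hd.2.2) (by omega)

/-! Fix a uniformizer `ϖ` of `F`; as `K/F` is unramified, it is also one of `K`. The statement is
proved for every closed subfield `L` of finite index in `K` containing `ϖ`, by strong induction on
`m = [K : L]`. Write `q` for the size of the residue field of `L`, `Q = q ^ m` for that of `K`, and
`v = Q ^ (-r/2)`, which does not depend on `L`.

Each `x ∈ 𝒪_K` is uniquely `τ + ϖ y` with `τ` the Teichmüller representative of its residue class
`c` and `y ∈ 𝒪_K`. The powers `x ^ Q ^ k` tend to `τ` and `𝒪_L[x]` is compact, so `τ ∈ 𝒪_L[x]`.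
Since `𝒪_L[τ]` is the full valuation ring of `L' = L(τ)`, it follows that `𝒪_L[x] = 𝒪_{L'}[ϖ y]`
(`integralAdjoin_teichmuller_add`). If `c` has degree `d` over the residue field of `L`, then `[K :
L'] = m / d` and `L'` has residue cardinality `q ^ d`.

Passing from `𝒪_{L'}[y]` to `𝒪_{L'}[ϖ y]` scales the `i`-th power of the generator by `ϖ ^ i`, so
the volume is divided by `(q ^ d) ^ (0 + 1 + ... + (m/d - 1))` (`measureReal_integralAdjoin_mul`).
The `r`-th power of this factor is `v ^ (m/d - 1)`. Integrating over residue classes gives `Q * I(L)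
= ∑ c, v ^ (m/d - 1) * I(L')` (`residueCard_mul_zetaIntegral`).

Möbius inversion counts the classes of degree `d` (`card_residueDegree_eq`). Those of degree one
have `L' = L` and return `I(L)` itself; solving for it, with `|v| < 1 < q`, gives the recursion of
`dFunction`. -/

open MeasureTheory Filter Topology

open scoped NNReal Pointwise

/-! ### Uniformizers, described by the norm. -/

/-- An element of maximal norm among the elements of norm less than `1`. -/
structure IsMaximalNormLTOne {K : Type*} [NormedField K] (ϖ : K) : Prop where
  ne_zero : ϖ ≠ 0
  norm_lt_one : ‖ϖ‖ < 1
  norm_le : ∀ x : K, ‖x‖ < 1 → ‖x‖ ≤ ‖ϖ‖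

namespace IsMaximalNormLTOne

variable {K : Type*} [NormedField K] {ϖ : K}

theorem norm_pos (h : IsMaximalNormLTOne ϖ) : 0 < ‖ϖ‖ := norm_pos_iff.2 h.ne_zero

theorem norm_div_le_one (h : IsMaximalNormLTOne ϖ) {x : K} (hx : ‖x‖ < 1) : ‖x / ϖ‖ ≤ 1 := by
  rw [norm_div, div_le_one h.norm_pos]
  exact h.norm_le x hx

theorem norm_mul_lt_one (h : IsMaximalNormLTOne ϖ) {x : K} (hx : ‖x‖ ≤ 1) : ‖ϖ * x‖ < 1 := by
  rw [norm_mul]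
  exact (mul_le_of_le_one_right (norm_nonneg _) hx).trans_lt h.norm_lt_one

theorem exists_norm_pow_mul_le_one (h : IsMaximalNormLTOne ϖ) (x : K) :
    ∃ k : ℕ, ‖ϖ ^ k * x‖ ≤ 1 := by
  have : Tendsto (fun k : ℕ => ‖ϖ‖ ^ k * ‖x‖) atTop (𝓝 (0 * ‖x‖)) :=
    (tendsto_pow_atTop_nhds_zero_of_lt_one h.norm_pos.le h.norm_lt_one).mul_const _
  rw [zero_mul] at this
  obtain ⟨k, hk⟩ := (this.eventually (gt_mem_nhds one_pos)).exists
  exact ⟨k, by simpa using hk.le⟩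

end IsMaximalNormLTOne

/-! ### Residue fields and existence of Teichmüller representatives. -/

namespace PAdicField

variable {p : ℕ} [Fact p.Prime] {K : Type*} [NormedField K] [NormedAlgebra ℚ_[p] K]

theorem norm_natCast_self_lt_one : ‖(p : K)‖ < 1 := by
  have h : ‖algebraMap ℚ_[p] K (p : ℚ_[p])‖ = ‖(p : ℚ_[p])‖ := norm_algebraMap' K _
  rw [map_natCast] at h
  rw [h]
  exact Padic.norm_p_lt_one

theorem natCast_self_ne_zero : (p : K) ≠ 0 := by
  have h : algebraMap ℚ_[p] K (p : ℚ_[p]) ≠ 0 := by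
    rw [Ne, map_eq_zero, Nat.cast_eq_zero]
    exact (Fact.out : p.Prime).ne_zero
  rwa [map_natCast] at h

theorem isUnit_integers_iff {a : integers p K} : IsUnit a ↔ ‖(a : K)‖ = 1 := by
  constructor
  · rintro ⟨u, rfl⟩
    have h1 := (mem_integers p).1 (u : integers p K).2
    have h2 := (mem_integers p).1 ((u⁻¹ : (integers p K)ˣ) : integers p K).2
    have h3 : ((u : integers p K) : K) * ((u⁻¹ : (integers p K)ˣ) : integers p K) = 1 := by
      exact congrArg (Subtype.val : integers p K → K) u.mul_inv
    have h4 := congrArg norm h3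
    rw [norm_mul, norm_one] at h4
    nlinarith [norm_nonneg ((u : integers p K) : K),
      norm_nonneg (((u⁻¹ : (integers p K)ˣ) : integers p K) : K)]
  · intro h
    have h0 : (a : K) ≠ 0 := by
      rw [← norm_pos_iff, h]
      exact one_pos
    refine IsUnit.of_mul_eq_one (⟨(a : K)⁻¹, (mem_integers p).2 (by rw [norm_inv, h, inv_one])⟩ :
      integers p K) ?_
    ext
    simp [h0]

theorem mem_maximalIdeal_iff {a : integers p K} :
    a ∈ IsLocalRing.maximalIdeal (integers p K) ↔ ‖(a : K)‖ < 1 := by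
  rw [IsLocalRing.mem_maximalIdeal, mem_nonunits_iff, isUnit_integers_iff]
  exact ⟨fun h => lt_of_le_of_ne ((mem_integers p).1 a.2) h, fun h => h.ne⟩

theorem residue_eq_residue_iff {a b : integers p K} :
    IsLocalRing.residue (integers p K) a = IsLocalRing.residue (integers p K) b ↔
      ‖(a : K) - b‖ < 1 := by
  rw [← sub_eq_zero, ← map_sub, IsLocalRing.residue_eq_zero_iff, mem_maximalIdeal_iff]
  simp

variable (p) in
theorem properSpace (K : Type*) [NormedField K] [NormedAlgebra ℚ_[p] K]
    [FiniteDimensional ℚ_[p] K] : ProperSpace K :=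
  FiniteDimensional.proper ℚ_[p] K

theorem coe_integers : (integers p K : Set K) = Metric.closedBall 0 1 := by
  ext x
  simp [mem_integers]

variable [FiniteDimensional ℚ_[p] K]

/-- In an ultrametric proper space the open unit ball is closed, hence compact, so the norm attains
its maximum there; the element `p` shows that this maximum is not zero. -/
theorem exists_isMaximalNormLTOne (p : ℕ) [Fact p.Prime] (K : Type*) [NormedField K]
    [NormedAlgebra ℚ_[p] K] [FiniteDimensional ℚ_[p] K] : ∃ ϖ : K, IsMaximalNormLTOne ϖ := by
  have := properSpace p K
  have := isUltrametricDist p K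
  have hc : IsCompact (Metric.ball (0 : K) 1) := by
    have hcl : IsClosed (Metric.ball (0 : K) 1) := IsUltrametricDist.isClosed_ball 0 1
    exact (isCompact_closedBall (0 : K) 1).of_isClosed_subset hcl Metric.ball_subset_closedBall
  obtain ⟨ϖ, h1, h2⟩ := hc.exists_isMaxOn ⟨0, by simp⟩ (continuous_norm.continuousOn)
  have h3 : ∀ x : K, ‖x‖ < 1 → ‖x‖ ≤ ‖ϖ‖ := fun x hx => h2 (by simpa using hx)
  refine ⟨ϖ, ?_, by simpa using h1, h3⟩
  rintro rfl
  have := h3 p (norm_natCast_self_lt_one (p := p) (K := K))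
  rw [norm_zero, norm_le_zero_iff] at this
  exact natCast_self_ne_zero (p := p) this

instance finite_residueField : Finite (IsLocalRing.ResidueField (integers p K)) := by
  have := properSpace p K
  obtain ⟨t, ht, htf, hcov⟩ := (isCompact_closedBall (0 : K) 1).finite_cover_balls one_pos
  have hsub : ∀ x ∈ t, ‖x‖ ≤ 1 := fun x hx => by simpa using ht hx
  have : Finite t := htf
  refine Finite.of_surjective (fun x : t => IsLocalRing.residue (integers p K)
    ⟨x, (mem_integers p).2 (hsub x x.2)⟩) fun c => ?_
  obtain ⟨a, rfl⟩ := IsLocalRing.residue_surjective c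
  have := hcov (show (a : K) ∈ Metric.closedBall 0 1 by simpa using (mem_integers p).1 a.2)
  simp only [Set.mem_iUnion, Metric.mem_ball, dist_eq_norm] at this
  obtain ⟨x, hx, hax⟩ := this
  refine ⟨⟨x, hx⟩, residue_eq_residue_iff.2 ?_⟩
  rwa [norm_sub_rev] at hax

theorem residue_pow_residueCard (c : IsLocalRing.ResidueField (integers p K)) :
    c ^ residueCard p K = c := by
  have := Fintype.ofFinite (IsLocalRing.ResidueField (integers p K))
  rw [residueCard, Nat.card_eq_fintype_card]
  exact FiniteField.pow_card c

theorem one_lt_residueCard : 1 < residueCard p K := Finite.one_lt_card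

instance charP_residueField : CharP (IsLocalRing.ResidueField (integers p K)) p := by
  have h0 : (p : IsLocalRing.ResidueField (integers p K)) = 0 := by
    have : IsLocalRing.residue (integers p K) (p : integers p K) = 0 := by
      rw [IsLocalRing.residue_eq_zero_iff, mem_maximalIdeal_iff]
      simpa using norm_natCast_self_lt_one (p := p) (K := K)
    simpa using this
  exact (CharP.charP_iff_prime_eq_zero Fact.out).2 h0

theorem exists_residueCard_eq_pow : ∃ f : ℕ, residueCard p K = p ^ f := by
  have := Fintype.ofFinite (IsLocalRing.ResidueField (integers p K))
  obtain ⟨f, -, hf⟩ := FiniteField.card (IsLocalRing.ResidueField (integers p K)) p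
  exact ⟨f, by rw [residueCard, Nat.card_eq_fintype_card, hf]⟩

/-- In `a ^ Q - b ^ Q = (∑ a ^ i * b ^ (Q - 1 - i)) * (a - b)` the sum reduces to `Q * a ^ (Q - 1) =
0` in the residue field, which gains one factor `‖ϖ‖`. -/
theorem norm_pow_residueCard_sub_le {ϖ : K} (hϖ : IsMaximalNormLTOne ϖ) {a b : K} {k : ℕ}
    (ha : ‖a‖ ≤ 1) (hb : ‖b‖ ≤ 1) (hab : ‖a - b‖ ≤ ‖ϖ‖ ^ (k + 1)) :
    ‖a ^ residueCard p K - b ^ residueCard p K‖ ≤ ‖ϖ‖ ^ (k + 2) := by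
  set a' : integers p K := ⟨a, (mem_integers p).2 ha⟩
  set b' : integers p K := ⟨b, (mem_integers p).2 hb⟩
  have hres : IsLocalRing.residue (integers p K) a' = IsLocalRing.residue (integers p K) b' :=
    residue_eq_residue_iff.2 (hab.trans_lt (pow_lt_one₀ hϖ.norm_pos.le hϖ.norm_lt_one (by omega)))
  set s : integers p K := ∑ i ∈ Finset.range (residueCard p K),
    a' ^ i * b' ^ (residueCard p K - 1 - i)
  have hs : ‖(s : K)‖ < 1 := by
    rw [← mem_maximalIdeal_iff, ← IsLocalRing.residue_eq_zero_iff]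
    simp only [s, map_sum, map_mul, map_pow, hres]
    rw [geom_sum₂_self]
    have := Fintype.ofFinite (IsLocalRing.ResidueField (integers p K))
    have : (residueCard p K : IsLocalRing.ResidueField (integers p K)) = 0 := by
      rw [residueCard, Nat.card_eq_fintype_card]
      exact FiniteField.cast_card_eq_zero _
    rw [this, zero_mul]
  have he : a ^ residueCard p K - b ^ residueCard p K = s * (a - b) := by
    have := congrArg (Subtype.val : integers p K → K) (geom_sum₂_mul a' b' (residueCard p K))
    simpa [s, a', b'] using this.symm
  rw [he, norm_mul, pow_succ' _ (k + 1)]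
  exact mul_le_mul (hϖ.norm_le _ hs) hab (norm_nonneg _) (norm_nonneg _)

theorem norm_pow_residueCard_pow_sub_le {ϖ : K} (hϖ : IsMaximalNormLTOne ϖ) {a b : K}
    (ha : ‖a‖ ≤ 1) (hb : ‖b‖ ≤ 1) (hab : ‖a - b‖ < 1) (k : ℕ) :
    ‖a ^ residueCard p K ^ k - b ^ residueCard p K ^ k‖ ≤ ‖ϖ‖ ^ (k + 1) := by
  induction k with
  | zero => simpa using hϖ.norm_le _ hab
  | succ k ih =>
    rw [pow_succ, pow_mul, pow_mul]
    exact norm_pow_residueCard_sub_le hϖ (by simpa using pow_le_one₀ (norm_nonneg _) ha)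
      (by simpa using pow_le_one₀ (norm_nonneg _) hb) ih

theorem eq_of_pow_residueCard_eq_self {a b : K} (ha : ‖a‖ ≤ 1) (hb : ‖b‖ ≤ 1)
    (hab : ‖a - b‖ < 1) (hat : a ^ residueCard p K = a) (hbt : b ^ residueCard p K = b) :
    a = b := by
  obtain ⟨ϖ, hϖ⟩ := exists_isMaximalNormLTOne p K
  have key : ∀ {c : K}, c ^ residueCard p K = c → ∀ k : ℕ, c ^ residueCard p K ^ k = c := by
    intro c hc k
    induction k with
    | zero => simp
    | succ k ih => rw [pow_succ, pow_mul, ih, hc]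
  have h : ∀ k : ℕ, ‖a - b‖ ≤ ‖ϖ‖ ^ (k + 1) := fun k => by
    simpa [key hat k, key hbt k] using norm_pow_residueCard_pow_sub_le (p := p) hϖ ha hb hab k
  have ht : Tendsto (fun k : ℕ => ‖ϖ‖ ^ (k + 1)) atTop (𝓝 0) :=
    (tendsto_pow_atTop_nhds_zero_of_lt_one hϖ.norm_pos.le hϖ.norm_lt_one).comp
      (tendsto_add_atTop_nat 1)
  rw [← sub_eq_zero, ← norm_le_zero_iff]
  exact ge_of_tendsto' ht h

/-- The representative is the limit of `x ^ Q ^ k` for any lift `x`: the sequence is Cauchy at a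
geometric rate because `x ^ Q` and `x` are congruent. -/
theorem exists_teichmuller (c : IsLocalRing.ResidueField (integers p K)) :
    ∃ a : integers p K, IsLocalRing.residue (integers p K) a = c ∧ a ^ residueCard p K = a := by
  have := properSpace p K
  obtain ⟨ϖ, hϖ⟩ := exists_isMaximalNormLTOne p K
  obtain ⟨x, rfl⟩ := IsLocalRing.residue_surjective c
  have hx := (mem_integers p).1 x.2
  have hpow : ∀ k : ℕ, ‖(x : K) ^ k‖ ≤ 1 := fun k => by
    simpa using pow_le_one₀ (norm_nonneg _) hx
  have hxx : ‖(x : K) - (x : K) ^ residueCard p K‖ < 1 := by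
    have := residue_eq_residue_iff (a := x) (b := x ^ residueCard p K)
    rw [map_pow, residue_pow_residueCard] at this
    simpa using this.1 rfl
  have hstep : ∀ k : ℕ, dist ((x : K) ^ residueCard p K ^ k) ((x : K) ^ residueCard p K ^ (k + 1)) ≤
      ‖ϖ‖ * ‖ϖ‖ ^ k := fun k => by
    rw [dist_eq_norm, ← pow_succ', pow_succ' (residueCard p K), pow_mul]
    exact norm_pow_residueCard_pow_sub_le hϖ hx (hpow _) hxx k
  obtain ⟨a, ha⟩ := cauchySeq_tendsto_of_complete
    (cauchySeq_of_le_geometric _ _ hϖ.norm_lt_one hstep)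
  have ha1 : ‖a‖ ≤ 1 := le_of_tendsto' ha.norm fun k => hpow _
  have hat : a ^ residueCard p K = a := by
    refine tendsto_nhds_unique (ha.pow (residueCard p K)) ?_
    simpa [← pow_mul, ← pow_succ] using (tendsto_add_atTop_iff_nat 1).2 ha
  have hxa : ‖a - x‖ < 1 := by
    have h1 : ∀ k : ℕ, ‖(x : K) ^ residueCard p K ^ k - x‖ ≤ ‖ϖ‖ := fun k => by
      refine hϖ.norm_le _ ?_
      have := residue_eq_residue_iff (a := x ^ residueCard p K ^ k) (b := x)
      have h2 : IsLocalRing.residue (integers p K) (x ^ residueCard p K ^ k) =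
          IsLocalRing.residue (integers p K) x := by
        induction k with
        | zero => simp
        | succ k ih => rw [pow_succ, pow_mul, map_pow, ih (residue_eq_residue_iff),
            residue_pow_residueCard]
      simpa using this.1 h2
    exact (le_of_tendsto' (ha.sub_const _).norm h1).trans_lt hϖ.norm_lt_one
  refine ⟨⟨a, (mem_integers p).2 ha1⟩, residue_eq_residue_iff.2 hxa, ?_⟩
  ext
  simpa using hat

end PAdicField

/-! ### Measure of a finite disjoint union of translates. -/

section IndexFormula

variable {E : Type*} [AddCommGroup E] [MeasurableSpace E] [MeasurableAdd E]

theorem measure_eq_card_mul_of_iUnion_translates (μ : Measure E) [μ.IsAddLeftInvariant]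
    {ι : Type*} [Fintype ι] {S T : Set E} (a : ι → E) (hT : MeasurableSet T)
    (hS : S = ⋃ i, (fun x => x - a i) ⁻¹' T)
    (hd : Pairwise (Function.onFun Disjoint fun i => (fun x => x - a i) ⁻¹' T)) :
    μ S = Fintype.card ι * μ T := by
  have h : ∀ i, (fun x => x - a i) ⁻¹' T = (fun x => -a i + x) ⁻¹' T := fun i => by
    simp only [sub_eq_neg_add]
  have hm : ∀ i, MeasurableSet ((fun x => x - a i) ⁻¹' T) := fun i => by
    rw [h]
    exact measurable_const_add _ hT
  rw [hS, measure_iUnion hd hm, tsum_fintype]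
  simp [h, measure_preimage_add]

end IndexFormula

/-! ### Diagonal automorphisms in a basis. -/

section Diagonal

@[simp]
theorem LinearEquiv.smulOfUnit_apply' {R M : Type*} [CommSemiring R] [AddCommMonoid M] [Module R M]
    (u : Rˣ) (x : M) : LinearEquiv.smulOfUnit u x = (u : R) • x := rfl

variable {F E ι : Type*} [Field F] [AddCommGroup E] [Module F E]

/-- The automorphism scaling the coordinates in a basis by given units. -/
noncomputable def Module.Basis.diagonal [Finite ι] (b : Module.Basis ι F E) :
    (ι → Fˣ) →* (E ≃ₗ[F] E) where
  toFun w := b.equivFun.trans ((LinearEquiv.piCongrRight fun i =>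
    LinearEquiv.smulOfUnit (w i)).trans b.equivFun.symm)
  map_one' := by
    ext x
    apply b.equivFun.injective
    ext i
    simp
  map_mul' w w' := by
    ext x
    apply b.equivFun.injective
    ext i
    simp [LinearEquiv.mul_apply, mul_assoc]

variable [Fintype ι] (b : Module.Basis ι F E)

theorem Module.Basis.repr_diagonal (w : ι → Fˣ) (x : E) (i : ι) :
    b.repr (b.diagonal w x) i = w i * b.repr x i := by
  change b.equivFun (b.equivFun.symm (fun i => (w i : F) • b.equivFun x i)) i = _
  rw [LinearEquiv.apply_symm_apply]
  simp

theorem Module.Basis.diagonal_apply_self (w : ι → Fˣ) (i : ι) :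
    b.diagonal w (b i) = (w i : F) • b i := by
  apply b.repr.injective
  ext j
  rw [b.repr_diagonal]
  by_cases h : i = j
  · subst h
    simp
  · simp [h]

theorem Module.Basis.diagonal_const (u : Fˣ) :
    b.diagonal (fun _ => u) = LinearEquiv.smulOfUnit u := by
  apply LinearEquiv.toLinearMap_injective
  refine b.ext fun i => ?_
  simpa using b.diagonal_apply_self (fun _ => u) i

end Diagonal

/-! ### The Haar modulus of linear automorphisms. -/

section HaarCharacter

variable {F E : Type*} [NontriviallyNormedField F] [CompleteSpace F] [NormedAddCommGroup E]
  [NormedSpace F E] [FiniteDimensional F E] [LocallyCompactSpace E] [MeasurableSpace E]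
  [BorelSpace E]

variable (F E) in
/-- The modulus of linear automorphisms with respect to Haar measure. -/
noncomputable def LinearEquiv.haarChar : (E ≃ₗ[F] E) →* ℝ≥0 where
  toFun T := addEquivAddHaarChar T.toContinuousLinearEquiv.toContinuousAddEquiv
  map_one' := addEquivAddHaarChar_refl
  map_mul' T S := by
    rw [mul_comm, ← addEquivAddHaarChar_trans]
    rfl

theorem LinearEquiv.measure_image (μ : Measure E) [μ.IsAddHaarMeasure] [μ.Regular]
    (T : E ≃ₗ[F] E) (S : Set E) :
    μ (T '' S) = LinearEquiv.haarChar F E T * μ S := by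
  have h := addEquivAddHaarChar_smul_preimage μ (X := T '' S)
    T.toContinuousLinearEquiv.toContinuousAddEquiv
  have h2 : T.toContinuousLinearEquiv.toContinuousAddEquiv ⁻¹' (T '' S) = S :=
    Set.preimage_image_eq S T.injective
  rw [h2] at h
  exact h.symm

theorem LinearEquiv.measureReal_image (μ : Measure E) [μ.IsAddHaarMeasure] [μ.Regular]
    (T : E ≃ₗ[F] E) (S : Set E) :
    μ.real (T '' S) = LinearEquiv.haarChar F E T * μ.real S := by
  simp [measureReal_def, T.measure_image μ S]

variable {ι : Type*} [Fintype ι] (b : Module.Basis ι F E) [DecidableEq ι]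

/-- Swapping two basis vectors conjugates one scaling into the other, and a character with
commutative values is constant on conjugacy classes. -/
theorem Module.Basis.haarChar_diagonal_mulSingle_eq (i j : ι) (u : Fˣ) :
    LinearEquiv.haarChar F E (b.diagonal (Pi.mulSingle i u)) =
      LinearEquiv.haarChar F E (b.diagonal (Pi.mulSingle j u)) := by
  set P : E ≃ₗ[F] E := b.equiv b (Equiv.swap i j)
  have h : P * b.diagonal (Pi.mulSingle i u) = b.diagonal (Pi.mulSingle j u) * P := by
    apply LinearEquiv.toLinearMap_injective
    refine b.ext fun k => ?_
    have hP : ∀ k, P (b k) = b (Equiv.swap i j k) := fun k => by simp [P]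
    have hk : (Pi.mulSingle i u : ι → Fˣ) k =
        (Pi.mulSingle j u : ι → Fˣ) (Equiv.swap i j k) := by
      by_cases hk : k = i
      · subst hk
        simp
      · rw [Pi.mulSingle_eq_of_ne hk, Pi.mulSingle_eq_of_ne]
        rw [Ne, Equiv.swap_apply_eq_iff, Equiv.swap_apply_right]
        exact hk
    simp only [LinearEquiv.coe_coe, LinearEquiv.mul_apply, b.diagonal_apply_self, map_smul, hP, hk]
  have h2 := congrArg (LinearEquiv.haarChar F E) h
  rw [map_mul, map_mul, mul_comm] at h2
  exact mul_right_cancel₀ (addEquivAddHaarChar_pos _).ne' h2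

theorem Module.Basis.haarChar_diagonal (j : ι) (w : ι → Fˣ) :
    LinearEquiv.haarChar F E (b.diagonal w) =
      ∏ i, LinearEquiv.haarChar F E (b.diagonal (Pi.mulSingle j (w i))) := by
  have h := map_prod ((LinearEquiv.haarChar F E).comp b.diagonal)
    (fun i => (Pi.mulSingle i (w i) : ι → Fˣ)) Finset.univ
  rw [Finset.univ_prod_mulSingle] at h
  refine h.trans ?_
  exact Finset.prod_congr rfl fun i _ => b.haarChar_diagonal_mulSingle_eq i j (w i)

theorem Module.Basis.haarChar_diagonal_mulSingle_pow_card (j : ι) (u : Fˣ) :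
    LinearEquiv.haarChar F E (b.diagonal (Pi.mulSingle j u)) ^ Fintype.card ι =
      LinearEquiv.haarChar F E (LinearEquiv.smulOfUnit u) := by
  rw [← b.diagonal_const, b.haarChar_diagonal j (fun _ => u), Finset.prod_const, Finset.card_univ]

/-- Extend a basis of `V` to `E` and scale by `u` one basis vector outside `V`. This fixes `S`
pointwise, yet multiplies its measure by a modulus different from `1`, since a power of that modulus
is the modulus of the scalar `u`. -/
theorem measure_eq_zero_of_subset_submodule (μ : Measure E) [μ.IsAddHaarMeasure] [μ.Regular]
    {u : Fˣ} (hu : LinearEquiv.haarChar F E (LinearEquiv.smulOfUnit u) ≠ 1)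
    {V : Submodule F E} (hV : V ≠ ⊤) {S : Set E} (hS : S ⊆ V) (hfin : μ S ≠ ⊤) : μ S = 0 := by
  classical
  have hli : LinearIndependent F (fun i => (Module.finBasis F V i : E)) :=
    (Module.finBasis F V).linearIndependent.map' V.subtype (Submodule.ker_subtype V)
  set b := Module.Basis.sumExtend hli
  have := FiniteDimensional.fintypeBasisIndex b
  have hbl : ∀ i, b (Sum.inl i) = Module.finBasis F V i := fun i => by
    simp [b, Module.Basis.sumExtend]
    rfl
  have hspan : ∀ T : E ≃ₗ[F] E, (∀ i, T (b (Sum.inl i)) = b (Sum.inl i)) → ∀ x ∈ V, T x = x := by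
    intro T hT x hx
    have : T.toLinearMap ∘ₗ V.subtype = V.subtype := by
      refine (Module.finBasis F V).ext fun i => ?_
      simpa [hbl] using hT i
    exact congrArg (fun f : V →ₗ[F] E => f ⟨x, hx⟩) this
  obtain ⟨j⟩ : Nonempty (Module.Basis.sumExtendIndex hli) := by
    by_contra hne
    rw [not_nonempty_iff] at hne
    refine hV (eq_top_iff.2 fun x _ => ?_)
    rw [← b.sum_repr x]
    refine Submodule.sum_mem _ fun i _ => Submodule.smul_mem _ _ ?_
    rcases i with i | i
    · rw [hbl]
      exact Subtype.property _
    · exact (hne.false i).elim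
  set T := b.diagonal (Pi.mulSingle (Sum.inr j) u)
  have hT : T '' S = S := by
    have : ∀ x ∈ S, T x = x := fun x hx => hspan T (fun i => by
      rw [b.diagonal_apply_self, Pi.mulSingle_eq_of_ne (by simp)]
      simp) x (hS hx)
    rw [Set.image_congr this, Set.image_id']
  have h := T.measure_image μ S
  rw [hT] at h
  by_contra h0
  have h1 : (LinearEquiv.haarChar F E T : ENNReal) = 1 := by
    have h2 : 1 * μ S = LinearEquiv.haarChar F E T * μ S := by rw [one_mul]; exact h
    exact ((ENNReal.mul_left_inj h0 hfin).1 h2).symm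
  apply hu
  rw [← b.haarChar_diagonal_mulSingle_pow_card (Sum.inr j) u]
  rw [ENNReal.coe_eq_one] at h1
  change LinearEquiv.haarChar F E T ^ _ = 1
  rw [h1, one_pow]

end HaarCharacter

/-! ### The modulus of scaling one coordinate by a uniformizer. -/

/-- A family representing each residue class of the unit ball exactly once. -/
structure IsResidueSystem {F κ : Type*} [NormedField F] (ρ : κ → F) : Prop where
  norm_le_one : ∀ c, ‖ρ c‖ ≤ 1
  exists_norm_sub_lt_one : ∀ a, ‖a‖ ≤ 1 → ∃ c, ‖a - ρ c‖ < 1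
  eq_of_norm_sub_lt_one : ∀ c c', ‖ρ c - ρ c'‖ < 1 → c = c'

section ResidueIndex

variable {F E : Type*} [NontriviallyNormedField F] [ProperSpace F]
  [NormedAddCommGroup E] [NormedSpace F E] [FiniteDimensional F E]
  {ι : Type*} [Fintype ι] (b : Module.Basis ι F E)

/-- The vectors whose coordinates in a basis have norm at most one. -/
def Module.Basis.unitBox : Set E := {x | ∀ i, ‖b.repr x i‖ ≤ 1}

theorem Module.Basis.unitBox_eq_image :
    b.unitBox = b.equivFun.toContinuousLinearEquiv.symm '' Metric.closedBall 0 1 := by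
  rw [ContinuousLinearEquiv.image_symm_eq_preimage]
  ext x
  simp [Module.Basis.unitBox, pi_norm_le_iff_of_nonneg]

theorem Module.Basis.isCompact_unitBox : IsCompact b.unitBox := by
  rw [b.unitBox_eq_image]
  exact (isCompact_closedBall _ _).image (ContinuousLinearEquiv.continuous _)

theorem Module.Basis.interior_unitBox_nonempty : (interior b.unitBox).Nonempty := by
  refine ⟨0, mem_interior_iff_mem_nhds.2 ?_⟩
  have h : b.unitBox = b.equivFun.toContinuousLinearEquiv ⁻¹' Metric.closedBall 0 1 := by
    rw [b.unitBox_eq_image, ContinuousLinearEquiv.image_symm_eq_preimage]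
  rw [h]
  refine (ContinuousLinearEquiv.continuous _).continuousAt.preimage_mem_nhds ?_
  rw [map_zero]
  exact Metric.closedBall_mem_nhds _ one_pos

variable [IsUltrametricDist F] [LocallyCompactSpace E] [MeasurableSpace E] [BorelSpace E]

/-- Scaling the `j`-th coordinate turns `‖·‖ ≤ 1` into `‖·‖ < 1` there, so the unit box is the
disjoint union of the translates of its image by `ρ c • b j`. -/
theorem Module.Basis.haarChar_diagonal_mulSingle_mul_card [DecidableEq ι] (μ : Measure E)
    [μ.IsAddHaarMeasure] [μ.Regular] {κ : Type*} [Fintype κ] {ρ : κ → F} (hρ : IsResidueSystem ρ)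
    {u : Fˣ} (hu : IsMaximalNormLTOne (u : F))
    (j : ι) :
    LinearEquiv.haarChar F E (b.diagonal (Pi.mulSingle j u)) * Fintype.card κ = 1 := by
  set T := b.diagonal (Pi.mulSingle j u)
  have hT : ∀ x, x ∈ T '' b.unitBox ↔ (∀ i, i ≠ j → ‖b.repr x i‖ ≤ 1) ∧ ‖b.repr x j‖ < 1 := by
    intro x
    constructor
    · rintro ⟨y, hy, rfl⟩
      refine ⟨fun i hi => ?_, ?_⟩
      · rw [b.repr_diagonal, Pi.mulSingle_eq_of_ne hi]
        simpa using hy i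
      · rw [b.repr_diagonal, Pi.mulSingle_eq_same]
        exact hu.norm_mul_lt_one (hy j)
    · rintro ⟨h1, h2⟩
      refine ⟨T.symm x, fun i => ?_, T.apply_symm_apply x⟩
      have h3 := b.repr_diagonal (Pi.mulSingle j u) (T.symm x) i
      rw [show b.diagonal (Pi.mulSingle j u) (T.symm x) = x from T.apply_symm_apply x] at h3
      by_cases hi : i = j
      · subst hi
        rw [Pi.mulSingle_eq_same] at h3
        have h4 : b.repr (T.symm x) i = b.repr x i / u := by
          rw [h3, mul_div_cancel_left₀ _ hu.ne_zero]
        rw [h4]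
        exact hu.norm_div_le_one h2
      · rw [Pi.mulSingle_eq_of_ne hi, Units.val_one, one_mul] at h3
        rw [← h3]
        exact h1 i hi
  have hsingle : ∀ (c : κ) (x : E) (i : ι), b.repr (x - ρ c • b j) i =
      b.repr x i - if i = j then ρ c else 0 := fun c x i => by
    by_cases hi : i = j
    · subst hi
      simp
    · simp [hi]
  have hcompact : IsCompact (T '' b.unitBox) :=
    b.isCompact_unitBox.image T.toContinuousLinearEquiv.continuous
  have h := measure_eq_card_mul_of_iUnion_translates μ (S := b.unitBox) (T := T '' b.unitBox)
    (fun c => ρ c • b j) hcompact.isClosed.measurableSet (by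
      ext x
      simp only [Set.mem_iUnion, Set.mem_preimage, hT, hsingle]
      constructor
      · intro hx
        obtain ⟨c, hc⟩ := hρ.exists_norm_sub_lt_one _ (hx j)
        refine ⟨c, fun i hi => ?_, by simpa using hc⟩
        simpa [hi] using hx i
      · rintro ⟨c, h1, h2⟩ i
        by_cases hi : i = j
        · subst hi
          simp only [if_true] at h2
          have := IsUltrametricDist.norm_add_le_max (b.repr x i - ρ c) (ρ c)
          rw [sub_add_cancel] at this
          exact this.trans (max_le h2.le (hρ.norm_le_one c))
        · simpa [hi] using h1 i hi) (by
      intro c c' hcc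
      rw [Function.onFun, Set.disjoint_left]
      intro x hx hx'
      simp only [Set.mem_preimage, hT, hsingle, if_true] at hx hx'
      refine hcc (hρ.eq_of_norm_sub_lt_one c c' ?_)
      have := IsUltrametricDist.norm_add_le_max (b.repr x j - ρ c') (-(b.repr x j - ρ c))
      rw [norm_neg, ← sub_eq_add_neg, sub_sub_sub_cancel_left] at this
      exact this.trans_lt (max_lt hx'.2 hx.2))
  rw [T.measure_image μ] at h
  have h0 : μ b.unitBox ≠ 0 :=
    (Measure.measure_pos_of_nonempty_interior μ b.interior_unitBox_nonempty).ne'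
  have ht : μ b.unitBox ≠ ⊤ := b.isCompact_unitBox.measure_ne_top
  rw [← mul_assoc] at h
  have h1 : (Fintype.card κ * LinearEquiv.haarChar F E T : ENNReal) = 1 := by
    refine (ENNReal.mul_left_inj h0 ht).1 ?_
    rw [← h, one_mul]
  rw [mul_comm]
  exact_mod_cast h1

end ResidueIndex

/-! ### Rings generated by one integral element, as spans of powers. -/

section AdjoinSpan

variable (F : Type*) [NormedField F] [IsUltrametricDist F]

/-- The subring of elements of norm at most one in an ultrametric field. -/
def normLEOneSubring : Subring F where
  carrier := {x | ‖x‖ ≤ 1}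
  mul_mem' := fun {a b} ha hb => by
    simpa using mul_le_one₀ (show ‖a‖ ≤ 1 from ha) (norm_nonneg b) hb
  one_mem' := by simp
  add_mem' := fun {a b} ha hb => (IsUltrametricDist.norm_add_le_max a b).trans (max_le ha hb)
  zero_mem' := by simp
  neg_mem' := by simp

variable {F} {K : Type*} [NormedField K] [NormedAlgebra F K]

/-- The integral relation makes the span of the powers stable under multiplication by `y`, hence by
the whole ring; applying this to `1` gives the nontrivial inclusion. -/
theorem closure_insert_eq_span {y : K} {d : ℕ} {a : Fin d → F} (ha : ∀ i, ‖a i‖ ≤ 1)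
    (hy : y ^ d = ∑ i, a i • y ^ (i : ℕ)) :
    (Subring.closure (insert y (algebraMap F K '' {x | ‖x‖ ≤ 1})) : Set K) =
      {x | ∃ c : Fin d → F, (∀ i, ‖c i‖ ≤ 1) ∧ ∑ i, c i • y ^ (i : ℕ) = x} := by
  set B := Subring.closure (insert y (algebraMap F K '' {x | ‖x‖ ≤ 1}))
  set A := normLEOneSubring F
  set N : Submodule A K := Submodule.span A (Set.range fun i : Fin d => y ^ (i : ℕ))
  have hN : ∀ x, x ∈ N ↔ ∃ c : Fin d → F, (∀ i, ‖c i‖ ≤ 1) ∧ ∑ i, c i • y ^ (i : ℕ) = x := by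
    intro x
    rw [Submodule.mem_span_range_iff_exists_fun]
    constructor
    · rintro ⟨c, hc⟩
      exact ⟨fun i => c i, fun i => (c i).2, hc⟩
    · rintro ⟨c, hc, hx⟩
      exact ⟨fun i => ⟨c i, hc i⟩, hx⟩
  have hpow : ∀ i < d, y ^ i ∈ N := fun i hi => Submodule.subset_span ⟨⟨i, hi⟩, rfl⟩
  have hyN : ∀ x ∈ N, y * x ∈ N := by
    intro x hx
    induction hx using Submodule.span_induction with
    | mem x hx =>
      obtain ⟨i, rfl⟩ := hx
      change y * y ^ (i : ℕ) ∈ N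
      rw [← pow_succ']
      rcases (Nat.succ_le_of_lt i.2).lt_or_eq with h | h
      · exact hpow _ h
      · rw [show (i : ℕ) + 1 = d from h, hy]
        exact (hN _).2 ⟨a, ha, rfl⟩
    | zero => simp
    | add u v _ _ hu hv =>
      rw [mul_add]
      exact N.add_mem hu hv
    | smul r u _ hu =>
      rw [mul_smul_comm]
      exact N.smul_mem r hu
  have hAN : ∀ r : F, ‖r‖ ≤ 1 → ∀ x ∈ N, algebraMap F K r * x ∈ N := fun r hr x hx => by
    rw [← Algebra.smul_def]
    exact N.smul_mem (⟨r, hr⟩ : A) hx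
  have hBN : ∀ z ∈ B, ∀ x ∈ N, z * x ∈ N := by
    intro z hz
    induction hz using Subring.closure_induction with
    | mem z hz =>
      rcases hz with rfl | ⟨r, hr, rfl⟩
      · exact hyN
      · exact hAN r hr
    | zero => simp
    | one => simp
    | add u v _ _ hu hv =>
      intro x hx
      rw [add_mul]
      exact N.add_mem (hu x hx) (hv x hx)
    | neg u _ hu =>
      intro x hx
      rw [neg_mul]
      exact N.neg_mem (hu x hx)
    | mul u v _ _ hu hv =>
      intro x hx
      rw [mul_assoc]
      exact hu _ (hv x hx)
  -- For `d = 0` the relation would read `1 = 0`.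
  have hd : 0 < d := by
    rcases Nat.eq_zero_or_pos d with rfl | h
    · simp at hy
    · exact h
  ext x
  rw [Set.mem_ofPred_eq, ← hN, SetLike.mem_coe]
  constructor
  · intro hx
    simpa using hBN x hx 1 (by simpa using hpow 0 hd)
  · intro hx
    obtain ⟨c, hc, rfl⟩ := (hN x).1 hx
    refine B.sum_mem fun i _ => ?_
    rw [Algebra.smul_def]
    exact B.mul_mem (Subring.subset_closure (Or.inr ⟨_, hc i, rfl⟩))
      (B.pow_mem (Subring.subset_closure (Or.inl rfl)) _)

end AdjoinSpan

/-! ### Effect on the volume of multiplying the generator by a uniformizer. -/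

section UnitAdjoin

variable {F K : Type*} [NontriviallyNormedField F] [ProperSpace F] [IsUltrametricDist F]
  [NormedField K] [NormedAlgebra F K] [FiniteDimensional F K]

/-- The norm of `K` is the spectral norm over the complete field `F`, so `‖y‖ ≤ 1` forces the
minimal polynomial to have coefficients in the unit ball. -/
theorem exists_pow_natDegree_minpoly_eq_sum {y : K} (hy : ‖y‖ ≤ 1) :
    ∃ a : Fin (minpoly F y).natDegree → F, (∀ i, ‖a i‖ ≤ 1) ∧
      y ^ (minpoly F y).natDegree = ∑ i, a i • y ^ (i : ℕ) := by
  have hm : (minpoly F y).Monic := minpoly.monic (Algebra.IsIntegral.isIntegral y)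
  have h1 : ∀ n, ‖(minpoly F y).coeff n‖ ≤ 1 := by
    rw [← spectralValue_le_one_iff hm]
    rw [NormedAlgebra.norm_eq_spectralNorm F y] at hy
    exact hy
  refine ⟨fun i => -(minpoly F y).coeff i, fun i => by simpa using h1 i, ?_⟩
  have h2 := minpoly.aeval F y
  rw [Polynomial.aeval_eq_sum_range, Finset.sum_range_succ, hm.coeff_natDegree, one_smul] at h2
  rw [eq_neg_of_add_eq_zero_right h2, ← Fin.sum_univ_eq_sum_range
    (fun i => (minpoly F y).coeff i • y ^ i), ← Finset.sum_neg_distrib]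
  simp

theorem isCompact_closure_insert {y : K} (hy : ‖y‖ ≤ 1) :
    IsCompact (Subring.closure (insert y (algebraMap F K '' {x | ‖x‖ ≤ 1})) : Set K) := by
  obtain ⟨a, ha, h⟩ := exists_pow_natDegree_minpoly_eq_sum (F := F) hy
  rw [closure_insert_eq_span ha h]
  have himg : {x | ∃ c : Fin (minpoly F y).natDegree → F, (∀ i, ‖c i‖ ≤ 1) ∧
      ∑ i, c i • y ^ (i : ℕ) = x} =
      (fun c : Fin (minpoly F y).natDegree → F => ∑ i, c i • y ^ (i : ℕ)) ''
        Metric.closedBall 0 1 := by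
    ext x
    simp [pi_norm_le_iff_of_nonneg]
  rw [himg]
  exact (isCompact_closedBall _ _).image (by fun_prop)

variable [LocallyCompactSpace K] [MeasurableSpace K] [BorelSpace K]

variable (μ : Measure K) [μ.IsAddHaarMeasure] [μ.Regular] {κ : Type*} [Fintype κ] {ρ : κ → F}
  {u : Fˣ}

theorem haarChar_smulOfUnit_mul_card_pow (hρ : IsResidueSystem ρ)
    (hu : IsMaximalNormLTOne (u : F)) :
    LinearEquiv.haarChar F K (LinearEquiv.smulOfUnit u) *
      (Fintype.card κ : ℝ≥0) ^ Module.finrank F K = 1 := by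
  set b := Module.finBasis F K
  have j : Fin (Module.finrank F K) := ⟨0, Module.finrank_pos⟩
  have h := b.haarChar_diagonal_mulSingle_mul_card Measure.addHaar hρ hu j
  have h2 := b.haarChar_diagonal_mulSingle_pow_card j u
  rw [Fintype.card_fin] at h2
  rw [← h2, ← mul_pow, h, one_pow]

/-- If `y` generates `K`, its powers form a basis and the two rings correspond under `diag(1, u, u ^
2, ...)`, whose modulus is the product of those of the entries. Otherwise both rings lie in a proper
subspace and have measure zero. -/
theorem measureReal_closure_insert_smul (hρ : IsResidueSystem ρ) (hκ : 1 < Fintype.card κ)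
    (hu : IsMaximalNormLTOne (u : F)) {y : K} (hy : ‖y‖ ≤ 1) :
    (Fintype.card κ : ℝ) ^ (∑ i ∈ Finset.range (Module.finrank F K), i) *
      μ.real (Subring.closure (insert ((u : F) • y) (algebraMap F K '' {x | ‖x‖ ≤ 1}))) =
    μ.real (Subring.closure (insert y (algebraMap F K '' {x | ‖x‖ ≤ 1}))) := by
  obtain ⟨a, ha, h⟩ := exists_pow_natDegree_minpoly_eq_sum (F := F) hy
  have hli : LinearIndependent F fun i : Fin (minpoly F y).natDegree => y ^ (i : ℕ) :=
    linearIndependent_pow y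
  generalize (minpoly F y).natDegree = d at a ha h hli
  have huy : ‖(u : F) • y‖ ≤ 1 := by
    rw [norm_smul]
    exact mul_le_one₀ hu.norm_lt_one.le (norm_nonneg _) hy
  -- Multiplying the relation for `y` by `u ^ d` gives one for `u • y` with these coefficients.
  have ha' : ∀ i : Fin d, ‖(u : F) ^ (d - i) * a i‖ ≤ 1 := fun i => by
    rw [norm_mul, norm_pow]
    exact mul_le_one₀ (pow_le_one₀ (norm_nonneg _) hu.norm_lt_one.le) (norm_nonneg _) (ha i)
  have h' : ((u : F) • y) ^ d = ∑ i : Fin d, ((u : F) ^ (d - i) * a i) •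
      ((u : F) • y) ^ (i : ℕ) := by
    rw [smul_pow, h, Finset.smul_sum]
    refine Finset.sum_congr rfl fun i _ => ?_
    rw [smul_pow, smul_smul, smul_smul]
    congr 1
    rw [mul_right_comm, ← pow_add, Nat.sub_add_cancel i.2.le]
  have hset := closure_insert_eq_span ha h
  have hset' := closure_insert_eq_span ha' h'
  have hc := (isCompact_closure_insert (F := F) hy).measure_ne_top (μ := μ)
  have hc' := (isCompact_closure_insert (F := F) huy).measure_ne_top (μ := μ)
  by_cases hd : d = Module.finrank F K
  · have hd0 : 0 < d := hd ▸ Module.finrank_pos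
    have : Nonempty (Fin d) := ⟨⟨0, hd0⟩⟩
    set b := basisOfLinearIndependentOfCardEqFinrank hli (by simpa using hd)
    have hb : ∀ i, b i = y ^ (i : ℕ) := fun i => by simp [b]
    set w : Fin d → Fˣ := fun i => u ^ (i : ℕ)
    have himg : (Subring.closure (insert ((u : F) • y)
        (algebraMap F K '' {x | ‖x‖ ≤ 1})) : Set K) = b.diagonal w ''
          (Subring.closure (insert y (algebraMap F K '' {x | ‖x‖ ≤ 1}))) := by
      have hT : ∀ c : Fin d → F, b.diagonal w (∑ i, c i • y ^ (i : ℕ)) =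
          ∑ i, c i • ((u : F) • y) ^ (i : ℕ) := fun c => by
        rw [map_sum]
        refine Finset.sum_congr rfl fun i _ => ?_
        rw [map_smul, ← hb, b.diagonal_apply_self, smul_pow, hb]
        simp [w]
      rw [hset, hset']
      ext x
      constructor
      · rintro ⟨c, hc, rfl⟩
        exact ⟨_, ⟨c, hc, rfl⟩, hT c⟩
      · rintro ⟨_, ⟨c, hc, rfl⟩, rfl⟩
        exact ⟨c, hc, (hT c).symm⟩
    rw [himg, LinearEquiv.measureReal_image, ← mul_assoc]
    have h1 := b.haarChar_diagonal_mulSingle_mul_card μ hρ hu ⟨0, hd0⟩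
    set g := LinearEquiv.haarChar F K (b.diagonal (Pi.mulSingle ⟨0, hd0⟩ u))
    have h2 : LinearEquiv.haarChar F K (b.diagonal w) = g ^ ∑ i ∈ Finset.range d, i := by
      rw [b.haarChar_diagonal ⟨0, hd0⟩, ← Fin.sum_univ_eq_sum_range (fun i => i),
        ← Finset.prod_pow_eq_pow_sum]
      refine Finset.prod_congr rfl fun i _ => ?_
      rw [← map_pow, ← map_pow, ← Pi.mulSingle_pow]
    rw [h2, ← hd]
    have h3 : (Fintype.card κ : ℝ) * g = 1 := by
      rw [mul_comm]
      exact_mod_cast h1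
    rw [NNReal.coe_pow, ← mul_pow, h3, one_pow, one_mul]
  · set V : Submodule F K := Submodule.span F (Set.range fun i : Fin d => y ^ (i : ℕ))
    have hV : V ≠ ⊤ := by
      intro hV
      apply hd
      have := finrank_span_eq_card hli
      rw [show Submodule.span F (Set.range fun i : Fin d => y ^ (i : ℕ)) = ⊤ from hV,
        finrank_top, Fintype.card_fin] at this
      exact this.symm
    have hu1 : LinearEquiv.haarChar F K (LinearEquiv.smulOfUnit u) ≠ 1 := by
      intro h1
      have h2 := haarChar_smulOfUnit_mul_card_pow (K := K) hρ hu
      rw [h1, one_mul] at h2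
      have h3 : Fintype.card κ ^ Module.finrank F K = 1 := by exact_mod_cast h2
      exact (one_lt_pow₀ hκ Module.finrank_pos.ne').ne' h3
    have hpow : ∀ i : Fin d, y ^ (i : ℕ) ∈ V := fun i => Submodule.subset_span ⟨i, rfl⟩
    have e1 : μ (Subring.closure (insert y (algebraMap F K '' {x | ‖x‖ ≤ 1})) : Set K) = 0 := by
      refine measure_eq_zero_of_subset_submodule μ hu1 hV ?_ hc
      rw [hset]
      rintro _ ⟨c, -, rfl⟩
      exact V.sum_mem fun i _ => V.smul_mem _ (hpow i)
    have e2 : μ (Subring.closure (insert ((u : F) • y)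
        (algebraMap F K '' {x | ‖x‖ ≤ 1})) : Set K) = 0 := by
      refine measure_eq_zero_of_subset_submodule μ hu1 hV ?_ hc'
      rw [hset']
      rintro _ ⟨c, -, rfl⟩
      refine V.sum_mem fun i _ => V.smul_mem _ ?_
      rw [smul_pow]
      exact V.smul_mem _ (hpow i)
    rw [measureReal_def, measureReal_def, e1, e2]
    simp

end UnitAdjoin

/-! ### Normalized Haar measure and integration over residue classes. -/

namespace PAdicField

variable {p : ℕ} [Fact p.Prime] {K : Type*} [NormedField K] [NormedAlgebra ℚ_[p] K]

theorem measurableSet_integers [MeasurableSpace K] [BorelSpace K] :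
    MeasurableSet (integers p K : Set K) := by
  rw [coe_integers]
  exact Metric.isClosed_closedBall.measurableSet

variable [FiniteDimensional ℚ_[p] K]

section Haar

variable [MeasurableSpace K] [BorelSpace K]

instance isAddHaarMeasure_haar : (haar p K).IsAddHaarMeasure := by
  have := properSpace p K
  unfold haar
  infer_instance

instance regular_haar : (haar p K).Regular := by
  have := properSpace p K
  unfold haar
  infer_instance

theorem haar_integers : haar p K (integers p K : Set K) = 1 :=
  Measure.addHaarMeasure_self

end Haar

/-- The Teichmüller representative of a residue class. -/
noncomputable def teichmuller (c : IsLocalRing.ResidueField (integers p K)) : integers p K :=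
  (exists_teichmuller c).choose

@[simp]
theorem residue_teichmuller (c : IsLocalRing.ResidueField (integers p K)) :
    IsLocalRing.residue (integers p K) (teichmuller c) = c :=
  (exists_teichmuller c).choose_spec.1

theorem norm_teichmuller_le_one (c : IsLocalRing.ResidueField (integers p K)) :
    ‖(teichmuller c : K)‖ ≤ 1 :=
  (mem_integers p).1 (teichmuller c).2

theorem teichmuller_pow_residueCard (c : IsLocalRing.ResidueField (integers p K)) :
    (teichmuller c : K) ^ residueCard p K = teichmuller c := by
  exact congrArg (Subtype.val : integers p K → K) (exists_teichmuller c).choose_spec.2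

/-- Both sides are fixed by the `Q`-th power map and have the same residue, so they coincide. -/
theorem teichmuller_pow_eq_self {c : IsLocalRing.ResidueField (integers p K)} {k : ℕ}
    (hc : c ^ k = c) : (teichmuller c : K) ^ k = teichmuller c := by
  refine eq_of_pow_residueCard_eq_self (p := p)
    (by simpa using pow_le_one₀ (norm_nonneg _) (norm_teichmuller_le_one c))
    (norm_teichmuller_le_one c) ?_ ?_ (teichmuller_pow_residueCard c)
  · have := residue_eq_residue_iff (a := teichmuller c ^ k) (b := teichmuller c)
    rw [map_pow, residue_teichmuller] at this
    simpa using this.1 hc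
  · rw [← pow_mul, mul_comm, pow_mul, teichmuller_pow_residueCard]

theorem _root_.IsMaximalNormLTOne.norm_mul_lt_one_iff {K : Type*} [NormedField K] {ϖ : K}
    (hϖ : IsMaximalNormLTOne ϖ) {x : K} :
    ‖ϖ * x‖ < 1 ↔ ‖x‖ ≤ 1 := by
  refine ⟨fun h => ?_, hϖ.norm_mul_lt_one⟩
  simpa [hϖ.ne_zero] using hϖ.norm_div_le_one h

section Decomposition

theorem integers_eq_iUnion_ball : (integers p K : Set K) =
    ⋃ c : IsLocalRing.ResidueField (integers p K),
      (fun x => x - (teichmuller c : K)) ⁻¹' Metric.ball 0 1 := by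
  have := isUltrametricDist p K
  ext x
  simp only [Set.mem_iUnion, Set.mem_preimage, mem_ball_zero_iff, SetLike.mem_coe, mem_integers]
  constructor
  · intro hx
    refine ⟨IsLocalRing.residue _ ⟨x, (mem_integers p).2 hx⟩, ?_⟩
    rw [norm_sub_rev]
    exact residue_eq_residue_iff.1 (residue_teichmuller _)
  · rintro ⟨c, hc⟩
    have := IsUltrametricDist.norm_add_le_max (x - teichmuller c) (teichmuller c : K)
    rw [sub_add_cancel] at this
    exact this.trans (max_le hc.le (norm_teichmuller_le_one c))

theorem pairwise_disjoint_ball : Pairwise (Function.onFun Disjoint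
    fun c : IsLocalRing.ResidueField (integers p K) =>
      (fun x => x - (teichmuller c : K)) ⁻¹' Metric.ball 0 1) := by
  have := isUltrametricDist p K
  intro c c' hcc
  rw [Function.onFun, Set.disjoint_left]
  intro x hx hx'
  simp only [Set.mem_preimage, mem_ball_zero_iff] at hx hx'
  apply hcc
  rw [← residue_teichmuller c, ← residue_teichmuller c', residue_eq_residue_iff]
  have := IsUltrametricDist.norm_add_le_max (x - (teichmuller c' : K))
    (-(x - (teichmuller c : K)))
  rw [norm_neg, ← sub_eq_add_neg, sub_sub_sub_cancel_left] at this
  exact this.trans_lt (max_lt hx' hx)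

variable [MeasurableSpace K] [BorelSpace K]

variable (p K) in
theorem residueCard_mul_haar_ball :
    (residueCard p K : ENNReal) * haar p K (Metric.ball 0 1) = 1 := by
  have := Fintype.ofFinite (IsLocalRing.ResidueField (integers p K))
  have h := measure_eq_card_mul_of_iUnion_translates (haar p K)
    (fun c : IsLocalRing.ResidueField (integers p K) => (teichmuller c : K))
    Metric.isOpen_ball.measurableSet integers_eq_iUnion_ball pairwise_disjoint_ball
  rw [haar_integers] at h
  rw [residueCard, Nat.card_eq_fintype_card, ← h]

/-- The pushforward is again a Haar measure, so it is enough to compare on the open unit ball, whose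
preimage is `𝒪_K`. -/
theorem map_mul_left_haar {ϖ : K} (hϖ : IsMaximalNormLTOne ϖ) :
    (haar p K).map (ϖ * ·) = (residueCard p K : ENNReal) • haar p K := by
  have := properSpace p K
  have hI : ((haar p K).map (ϖ * ·)).IsAddHaarMeasure :=
    (AddAut.mulLeft (Units.mk0 ϖ hϖ.ne_zero)).isAddHaarMeasure_map (haar p K)
      (continuous_const_mul ϖ) (continuous_const_mul _)
  have hball := residueCard_mul_haar_ball p K
  have hc := Measure.isAddLeftInvariant_eq_smul ((haar p K).map (ϖ * ·)) (haar p K)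
  set c := Measure.addHaarScalarFactor ((haar p K).map (ϖ * ·)) (haar p K)
  have h1 : ((haar p K).map (ϖ * ·)) (Metric.ball 0 1) = 1 := by
    rw [Measure.map_apply (measurable_const_mul ϖ) Metric.isOpen_ball.measurableSet,
      ← haar_integers (p := p) (K := K)]
    congr 1
    ext x
    simpa [mem_integers] using hϖ.norm_mul_lt_one_iff
  rw [hc] at h1 ⊢
  change (c : ENNReal) • haar p K = _
  congr 1
  change (c : ENNReal) * _ = _ at h1
  have h0 : haar p K (Metric.ball 0 1) ≠ 0 := by
    intro h0
    simp [h0] at hball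
  have ht : haar p K (Metric.ball 0 1) ≠ ⊤ := Metric.isBounded_ball.measure_lt_top.ne
  exact (ENNReal.mul_left_inj h0 ht).1 (h1.trans hball.symm)

theorem setIntegral_integers_eq_sum {ϖ : K} (hϖ : IsMaximalNormLTOne ϖ)
    [Fintype (IsLocalRing.ResidueField (integers p K))] {f : K → ℂ}
    (hf : IntegrableOn f (integers p K) (haar p K)) :
    ∫ x in (integers p K : Set K), f x ∂(haar p K) =
      (residueCard p K : ℂ)⁻¹ * ∑ c : IsLocalRing.ResidueField (integers p K),
        ∫ y in (integers p K : Set K), f (teichmuller c + ϖ * y) ∂(haar p K) := by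
  have hm : ∀ c : IsLocalRing.ResidueField (integers p K),
      MeasurableSet ((fun x => x - (teichmuller c : K)) ⁻¹' Metric.ball 0 1) := fun c =>
    (measurable_sub_const _) Metric.isOpen_ball.measurableSet
  have hQ : (residueCard p K : ℂ) ≠ 0 := by
    exact_mod_cast (one_lt_residueCard (p := p) (K := K)).ne_bot
  rw [integers_eq_iUnion_ball] at hf
  conv_lhs => rw [integers_eq_iUnion_ball]
  rw [integral_iUnion_fintype hm pairwise_disjoint_ball
    (fun c => hf.mono_set (Set.subset_iUnion (fun c : IsLocalRing.ResidueField (integers p K) =>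
      (fun x => x - (teichmuller c : K)) ⁻¹' Metric.ball 0 1) c)), Finset.mul_sum]
  refine Finset.sum_congr rfl fun c _ => ?_
  have e1 : ∫ x in (fun x => x - (teichmuller c : K)) ⁻¹' Metric.ball 0 1, f x ∂(haar p K) =
      ∫ x in Metric.ball 0 1, f (teichmuller c + x) ∂(haar p K) := by
    have hmp := measurePreserving_sub_right (haar p K) (teichmuller c : K)
    have := hmp.setIntegral_preimage_emb
      (MeasurableEquiv.subRight (teichmuller c : K)).measurableEmbedding
      (fun x => f (teichmuller c + x)) (Metric.ball 0 1)
    simpa using this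
  have e2 : ∫ y in (integers p K : Set K), f (teichmuller c + ϖ * y) ∂(haar p K) =
      ∫ x in Metric.ball 0 1, f (teichmuller c + x) ∂((haar p K).map (ϖ * ·)) := by
    have hemb : MeasurableEmbedding (fun x : K => ϖ * x) :=
      (MeasurableEquiv.mulLeft₀ ϖ hϖ.ne_zero).measurableEmbedding
    rw [hemb.setIntegral_map]
    congr 2
    ext x
    simpa [mem_integers] using hϖ.norm_mul_lt_one_iff.symm
  rw [e1, e2, map_mul_left_haar hϖ, Measure.restrict_smul, integral_smul_measure]
  simp [hQ]

end Decomposition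

end PAdicField

/-! ### Closed subfields of finite index and their residue rings. -/

/-- The elements of norm at most one of a subfield. -/
def Subfield.unitBall {K : Type*} [NormedField K] (L : Subfield K) : Set K :=
  {x | x ∈ L ∧ ‖x‖ ≤ 1}

/-- The ring generated by an element over the unit ball of a subfield. -/
def Subfield.integralAdjoin {K : Type*} [NormedField K] (L : Subfield K) (y : K) : Subring K :=
  Subring.closure (insert y L.unitBall)

/-- A closed subfield of finite index which contains a given element. -/
structure Subfield.IsClosedFiniteWith {K : Type*} [NormedField K] (ϖ : K) (L : Subfield K) :
    Prop where
  isClosed : IsClosed (L : Set K)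
  mem : ϖ ∈ L
  finite : FiniteDimensional L K

namespace Subfield

section Normed

variable {K : Type*} [NormedField K]

/-- A normed field is a normed algebra over its subfields. -/
@[reducible]
def normedAlgebra (L : Subfield K) : NormedAlgebra L K where
  norm_smul_le a x := by
    rw [Algebra.smul_def]
    exact norm_mul_le _ _

/-- A subfield containing an element of norm strictly between `0` and `1` is nontrivially normed. -/
@[reducible]
def nontriviallyNormedField (L : Subfield K) {ϖ : K} (hϖ : IsMaximalNormLTOne ϖ) (h : ϖ ∈ L) :
    NontriviallyNormedField L where
  __ := SubfieldClass.toNormedField L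
  non_trivial := ⟨⟨ϖ⁻¹, L.inv_mem h⟩, by
    change 1 < ‖ϖ⁻¹‖
    rw [norm_inv]
    exact (one_lt_inv₀ hϖ.norm_pos).2 hϖ.norm_lt_one⟩

theorem image_algebraMap_eq_unitBall (L : Subfield K) :
    algebraMap L K '' {x | ‖x‖ ≤ 1} = L.unitBall := by
  ext x
  constructor
  · rintro ⟨y, hy, rfl⟩
    exact ⟨y.2, hy⟩
  · rintro ⟨hx, hx1⟩
    exact ⟨⟨x, hx⟩, hx1, rfl⟩

theorem unitBall_subset_integralAdjoin (L : Subfield K) (y : K) :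
    L.unitBall ⊆ L.integralAdjoin y :=
  (Set.subset_insert _ _).trans Subring.subset_closure

theorem self_mem_integralAdjoin (L : Subfield K) (y : K) : y ∈ L.integralAdjoin y :=
  Subring.subset_closure (Set.mem_insert _ _)

theorem integralAdjoin_le {L : Subfield K} {y : K} {S : Subring K} (hy : y ∈ S)
    (hL : L.unitBall ⊆ S) : L.integralAdjoin y ≤ S :=
  Subring.closure_le.2 (Set.insert_subset hy hL)

variable {ϖ : K} {L : Subfield K} [ProperSpace K]

theorem properSpace_of_isClosed (hL : IsClosed (L : Set K)) : ProperSpace L :=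
  ProperSpace.of_isClosed hL

theorem isCompact_integralAdjoin [IsUltrametricDist K] (hϖ : IsMaximalNormLTOne ϖ)
    (hL : L.IsClosedFiniteWith ϖ) {y : K} (hy : ‖y‖ ≤ 1) : IsCompact (L.integralAdjoin y : Set K) := by
  have := properSpace_of_isClosed hL.isClosed
  have := hL.finite
  let := L.nontriviallyNormedField hϖ hL.mem
  let := L.normedAlgebra
  have h := isCompact_closure_insert (F := L) hy
  rw [image_algebraMap_eq_unitBall] at h
  exact h

end Normed

variable {p : ℕ} [Fact p.Prime] {K : Type*} [NormedField K] [NormedAlgebra ℚ_[p] K]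

variable (p) in
/-- The residue ring of a subfield, inside the residue field of the whole field. -/
noncomputable def residueSubring (L : Subfield K) :
    Subring (IsLocalRing.ResidueField (PAdicField.integers p K)) :=
  (L.toSubring.comap (PAdicField.integers p K).subtype).map
    (IsLocalRing.residue (PAdicField.integers p K))

theorem mem_residueSubring {L : Subfield K}
    {c : IsLocalRing.ResidueField (PAdicField.integers p K)} :
    c ∈ L.residueSubring p ↔ ∃ a : PAdicField.integers p K, (a : K) ∈ L ∧
      IsLocalRing.residue (PAdicField.integers p K) a = c :=
  Iff.rfl

variable (p) in
theorem exists_isResidueSystem (L : Subfield K) :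
    ∃ ρ : L.residueSubring p → L, IsResidueSystem ρ := by
  choose a ha hac using fun c : L.residueSubring p => mem_residueSubring.1 c.2
  refine ⟨fun c => ⟨a c, ha c⟩, fun c => (PAdicField.mem_integers p (x := (a c : K))).1 (a c).2,
    fun x hx => ?_, fun c c' h => ?_⟩
  · set x' : PAdicField.integers p K := ⟨x, (PAdicField.mem_integers p).2 hx⟩
    have hx' : IsLocalRing.residue _ x' ∈ L.residueSubring p := ⟨x', x.2, rfl⟩
    refine ⟨⟨_, hx'⟩, ?_⟩
    exact PAdicField.residue_eq_residue_iff.1 (hac ⟨_, hx'⟩).symm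
  · have := PAdicField.residue_eq_residue_iff.2 (show ‖(a c : K) - a c'‖ < 1 from h)
    rw [hac, hac] at this
    exact Subtype.ext this

variable [FiniteDimensional ℚ_[p] K] {ϖ : K} {L : Subfield K}

section Measure

variable [MeasurableSpace K] [BorelSpace K]

theorem measureReal_integralAdjoin_mul (hϖ : IsMaximalNormLTOne ϖ) (hL : L.IsClosedFiniteWith ϖ)
    (hq : 1 < Nat.card (L.residueSubring p)) {y : K} (hy : ‖y‖ ≤ 1) :
    (Nat.card (L.residueSubring p) : ℝ) ^ (∑ i ∈ Finset.range (Module.finrank L K), i) *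
      (PAdicField.haar p K).real (L.integralAdjoin (ϖ * y)) =
    (PAdicField.haar p K).real (L.integralAdjoin y) := by
  have := PAdicField.isUltrametricDist p K
  have := PAdicField.properSpace p K
  have := properSpace_of_isClosed hL.isClosed
  have := hL.finite
  let := L.nontriviallyNormedField hϖ hL.mem
  let := L.normedAlgebra
  obtain ⟨ρ, hρ⟩ := L.exists_isResidueSystem p
  have := Fintype.ofFinite (L.residueSubring p)
  have hu : IsMaximalNormLTOne (Units.mk0 (⟨ϖ, hL.mem⟩ : L)
      (fun h => hϖ.ne_zero (congrArg Subtype.val h)) : L) :=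
    ⟨fun h => hϖ.ne_zero (congrArg Subtype.val h), hϖ.norm_lt_one, fun x hx => hϖ.norm_le x hx⟩
  rw [Nat.card_eq_fintype_card] at hq ⊢
  have h := measureReal_closure_insert_smul (PAdicField.haar p K) hρ hq hu hy
  rw [image_algebraMap_eq_unitBall] at h
  exact h

/-- Compute the volume of `ϖ 𝒪_K` in two ways: by the modulus of the scalar `ϖ` on the `L`-space
`K`, and as that of the open unit ball. This is `n = e f` with `e = 1`, since `ϖ ∈ L`. -/
theorem card_residueSubring_pow_finrank (hϖ : IsMaximalNormLTOne ϖ)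
    (hL : L.IsClosedFiniteWith ϖ) :
    Nat.card (L.residueSubring p) ^ Module.finrank L K = PAdicField.residueCard p K := by
  have := PAdicField.isUltrametricDist p K
  have := PAdicField.properSpace p K
  have := properSpace_of_isClosed hL.isClosed
  have := hL.finite
  let := L.nontriviallyNormedField hϖ hL.mem
  let := L.normedAlgebra
  obtain ⟨ρ, hρ⟩ := L.exists_isResidueSystem p
  have := Fintype.ofFinite (L.residueSubring p)
  set u : Lˣ := Units.mk0 (⟨ϖ, hL.mem⟩ : L) (fun h => hϖ.ne_zero (congrArg Subtype.val h))
  have hu : IsMaximalNormLTOne (u : L) :=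
    ⟨fun h => hϖ.ne_zero (congrArg Subtype.val h), hϖ.norm_lt_one, fun x hx => hϖ.norm_le x hx⟩
  have h1 := haarChar_smulOfUnit_mul_card_pow (K := K) hρ hu
  have h2 := LinearEquiv.measureReal_image (PAdicField.haar p K)
    (LinearEquiv.smulOfUnit u : K ≃ₗ[L] K) (PAdicField.integers p K)
  have h3 : (LinearEquiv.smulOfUnit u : K ≃ₗ[L] K) '' (PAdicField.integers p K) =
      Metric.ball 0 1 := by
    ext x
    rw [mem_ball_zero_iff]
    constructor
    · rintro ⟨y, hy, rfl⟩
      exact hϖ.norm_mul_lt_one ((PAdicField.mem_integers p).1 hy)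
    · intro hx
      exact ⟨x / ϖ, (PAdicField.mem_integers p).2 (hϖ.norm_div_le_one hx),
        mul_div_cancel₀ x hϖ.ne_zero⟩
  have h4 := congrArg ENNReal.toReal (PAdicField.residueCard_mul_haar_ball p K)
  rw [ENNReal.toReal_mul, ENNReal.toReal_natCast, ENNReal.toReal_one, ← measureReal_def, ← h3,
    h2, measureReal_def, PAdicField.haar_integers, ENNReal.toReal_one, mul_one] at h4
  have h5 : (LinearEquiv.haarChar L K (LinearEquiv.smulOfUnit u) : ℝ) *
      (Fintype.card (L.residueSubring p) : ℝ) ^ Module.finrank L K = 1 := by exact_mod_cast h1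
  rw [Nat.card_eq_fintype_card]
  have h6 : (LinearEquiv.haarChar L K (LinearEquiv.smulOfUnit u) : ℝ) ≠ 0 := by
    intro h0
    simp [h0] at h5
  rw [mul_comm, ← h5] at h4
  exact_mod_cast (mul_left_cancel₀ h6 h4).symm

end Measure

end Subfield

/-! ### The valuation ring of a field generated by a Teichmüller element. -/

namespace Subfield

variable {p : ℕ} [Fact p.Prime] {K : Type*} [NormedField K] [NormedAlgebra ℚ_[p] K]
  [FiniteDimensional ℚ_[p] K] {ϖ : K} {L : Subfield K}

open PAdicField

/-- A finite domain is a field, so Fermat's little theorem applies to the residue ring. -/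
theorem residueSubring_pow_card {c : IsLocalRing.ResidueField (integers p K)}
    (hc : c ∈ L.residueSubring p) : c ^ Nat.card (L.residueSubring p) = c := by
  have := Fintype.ofFinite (L.residueSubring p)
  classical
  let := Fintype.groupWithZeroOfCancel (L.residueSubring p)
  have h := FiniteField.pow_card (⟨c, hc⟩ : L.residueSubring p)
  rw [Nat.card_eq_fintype_card]
  exact congrArg Subtype.val h

variable (p) in
theorem norm_pow_card_pow_sub_self_lt_one {a : K} (ha : a ∈ L.unitBall) (k : ℕ) :
    ‖a ^ Nat.card (L.residueSubring p) ^ k - a‖ < 1 := by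
  set a' : integers p K := ⟨a, (mem_integers p).2 ha.2⟩
  have h : IsLocalRing.residue _ (a' ^ Nat.card (L.residueSubring p) ^ k) =
      IsLocalRing.residue _ a' := by
    induction k with
    | zero => simp
    | succ k ih => rw [pow_succ, pow_mul, map_pow, ih,
        residueSubring_pow_card (mem_residueSubring.2 ⟨a', ha.1, rfl⟩)]
  exact residue_eq_residue_iff.1 h

theorem one_lt_card_residueSubring : 1 < Nat.card (L.residueSubring p) := Finite.one_lt_card

theorem div_mem_unitBall (hϖ : IsMaximalNormLTOne ϖ) (hL : ϖ ∈ L) {a : K} (ha : a ∈ L)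
    (ha1 : ‖a‖ < 1) : a / ϖ ∈ L.unitBall :=
  ⟨L.div_mem ha hL, hϖ.norm_div_le_one ha1⟩

section Teichmuller

variable {τ : K} {k : ℕ}

/-- Modulo `ϖ` inside the ring itself, the `q ^ k`-th power map is a ring homomorphism, because the
binomial cross terms carry a factor `p` and `p / ϖ ∈ 𝒪_L`. It fixes the generators: `τ` by
hypothesis and `𝒪_L` by its residue field. -/
theorem exists_pow_sub_self_eq_mul (hϖ : IsMaximalNormLTOne ϖ) (hL : ϖ ∈ L)
    {f : ℕ} (hf : Nat.card (L.residueSubring p) = p ^ f)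
    (hτ : τ ^ Nat.card (L.residueSubring p) ^ k = τ) {z : K} (hz : z ∈ L.integralAdjoin τ) :
    ∃ w ∈ L.integralAdjoin τ, z ^ Nat.card (L.residueSubring p) ^ k - z = ϖ * w := by
  have hball : ∀ a ∈ L.unitBall,
      ∃ w ∈ L.integralAdjoin τ, a ^ Nat.card (L.residueSubring p) ^ k - a = ϖ * w := by
    intro a ha
    exact ⟨_, L.unitBall_subset_integralAdjoin τ (div_mem_unitBall hϖ hL
      (L.sub_mem (L.pow_mem ha.1 _) ha.1) (norm_pow_card_pow_sub_self_lt_one p ha k)),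
      (mul_div_cancel₀ _ hϖ.ne_zero).symm⟩
  have hmul : ∀ x ∈ L.integralAdjoin τ, ∀ y ∈ L.integralAdjoin τ,
      (∃ w ∈ L.integralAdjoin τ, x ^ Nat.card (L.residueSubring p) ^ k - x = ϖ * w) →
      (∃ w ∈ L.integralAdjoin τ, y ^ Nat.card (L.residueSubring p) ^ k - y = ϖ * w) →
      ∃ w ∈ L.integralAdjoin τ, (x * y) ^ Nat.card (L.residueSubring p) ^ k - x * y = ϖ * w := by
    rintro x hx y hy ⟨w, hw, hxw⟩ ⟨v, hv, hyv⟩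
    refine ⟨w * y ^ Nat.card (L.residueSubring p) ^ k + x * v,
      add_mem (mul_mem hw (pow_mem hy _)) (mul_mem hx hv), ?_⟩
    rw [mul_pow]
    linear_combination y ^ Nat.card (L.residueSubring p) ^ k * hxw + x * hyv
  have hneg1 : (-1 : K) ∈ L.unitBall := ⟨L.neg_mem L.one_mem, by simp⟩
  induction hz using Subring.closure_induction with
  | mem z hz =>
    rcases hz with rfl | hz
    · exact ⟨0, zero_mem _, by rw [hτ]; simp⟩
    · exact hball z hz
  | zero => exact hball 0 ⟨L.zero_mem, by simp⟩
  | one => exact hball 1 ⟨L.one_mem, by simp⟩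
  | add x y hx hy ihx ihy =>
    obtain ⟨w, hw, hxw⟩ := ihx
    obtain ⟨v, hv, hyv⟩ := ihy
    obtain ⟨r, hr⟩ := exists_add_pow_prime_pow_eq (Fact.out : p.Prime)
      (⟨x, hx⟩ : L.integralAdjoin τ) (⟨y, hy⟩ : L.integralAdjoin τ) (f * k)
    have hr' := congrArg (Subtype.val : L.integralAdjoin τ → K) hr
    have hpϖ : (p : K) / ϖ ∈ L.integralAdjoin τ := L.unitBall_subset_integralAdjoin τ
      (div_mem_unitBall hϖ hL (natCast_mem L p) (norm_natCast_self_lt_one (p := p)))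
    refine ⟨w + v + (p : K) / ϖ * (x * y * r), add_mem (add_mem hw hv) (mul_mem hpϖ
      (mul_mem (mul_mem hx hy) r.2)), ?_⟩
    rw [hf, ← pow_mul] at hxw hyv ⊢
    have hr'' : (x + y) ^ p ^ (f * k) = x ^ p ^ (f * k) + y ^ p ^ (f * k) +
      p * x * y * r := by simpa using hr'
    have h0 : ϖ * ((p : K) / ϖ) = p := mul_div_cancel₀ _ hϖ.ne_zero
    linear_combination hr'' + hxw + hyv - x * y * r * h0
  | neg x hx ih =>
    -- Treating negation as a product with `-1` avoids a discussion of the parity of the exponent.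
    rw [neg_eq_neg_one_mul]
    exact hmul _ (L.unitBall_subset_integralAdjoin τ hneg1) _ hx (hball _ hneg1) ih
  | mul x y hx hy ihx ihy => exact hmul x hx y hy ihx ihy

/-- Write `R = 𝒪_L[τ]`. Each `z - z ^ N ^ j` lies in `ϖ R`, and `z ^ N ^ j` tends to `0` as `‖z‖ <
1`; since `ϖ R` is compact, it contains the limit `z`. -/
theorem div_mem_integralAdjoin (hϖ : IsMaximalNormLTOne ϖ) (hL : L.IsClosedFiniteWith ϖ)
    {f : ℕ} (hf : Nat.card (L.residueSubring p) = p ^ f) (hk : k ≠ 0) (hτ1 : ‖τ‖ ≤ 1)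
    (hτ : τ ^ Nat.card (L.residueSubring p) ^ k = τ) {z : K} (hz : z ∈ L.integralAdjoin τ)
    (hz1 : ‖z‖ < 1) : z / ϖ ∈ L.integralAdjoin τ := by
  have := isUltrametricDist p K
  have := properSpace p K
  set N := Nat.card (L.residueSubring p) ^ k
  have hN : 1 < N := one_lt_pow₀ one_lt_card_residueSubring hk
  have hclosed : IsClosed ((ϖ * ·) '' (L.integralAdjoin τ : Set K)) :=
    ((isCompact_integralAdjoin hϖ hL hτ1).image (continuous_const_mul ϖ)).isClosed
  have hmem : ∀ j : ℕ, z - z ^ N ^ j ∈ (ϖ * ·) '' (L.integralAdjoin τ : Set K) := by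
    intro j
    induction j with
    | zero => exact ⟨0, zero_mem _, by simp⟩
    | succ j ih =>
      obtain ⟨w, hw, hwz⟩ := ih
      obtain ⟨v, hv, hvz⟩ := exists_pow_sub_self_eq_mul hϖ hL.mem hf hτ (pow_mem hz (N ^ j))
      refine ⟨w - v, sub_mem hw hv, ?_⟩
      rw [pow_succ, pow_mul]
      simp only at hwz ⊢
      linear_combination hwz + hvz
  have hlim : Tendsto (fun j : ℕ => z - z ^ N ^ j) atTop (𝓝 (z - 0)) := by
    refine tendsto_const_nhds.sub ?_
    exact (tendsto_pow_atTop_nhds_zero_of_norm_lt_one hz1).comp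
      (tendsto_pow_atTop_atTop_of_one_lt hN)
  rw [sub_zero] at hlim
  obtain ⟨w, hw, hwz⟩ := hclosed.mem_of_tendsto hlim (Eventually.of_forall hmem)
  rw [← show ϖ * w = z from hwz, mul_div_cancel_left₀ _ hϖ.ne_zero]
  exact hw

/-- The subfield generated by an element over a subfield. -/
def adjoinSimple (L : Subfield K) (τ : K) : Subfield K :=
  (IntermediateField.adjoin L {τ}).toSubfield

theorem le_adjoinSimple : L ≤ L.adjoinSimple τ := fun x hx =>
  (IntermediateField.adjoin L {τ}).algebraMap_mem ⟨x, hx⟩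

theorem self_mem_adjoinSimple : τ ∈ L.adjoinSimple τ :=
  IntermediateField.mem_adjoin_simple_self L τ

/-- Any element of `L(τ)` enters `𝒪_L[τ]` after multiplication by some `ϖ ^ j`. If it has norm at
most one, the factors `ϖ` can be removed one at a time by `div_mem_integralAdjoin`. -/
theorem unitBall_adjoinSimple (hϖ : IsMaximalNormLTOne ϖ) (hL : L.IsClosedFiniteWith ϖ)
    {f : ℕ} (hf : Nat.card (L.residueSubring p) = p ^ f) (hk : k ≠ 0) (hτ1 : ‖τ‖ ≤ 1)
    (hτ : τ ^ Nat.card (L.residueSubring p) ^ k = τ) :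
    (L.adjoinSimple τ).unitBall = L.integralAdjoin τ := by
  have := isUltrametricDist p K
  have := hL.finite
  have hunit : ∀ j : ℕ, ϖ ^ j ∈ L.integralAdjoin τ := fun j => pow_mem
    (L.unitBall_subset_integralAdjoin τ ⟨hL.mem, hϖ.norm_lt_one.le⟩) j
  apply Set.Subset.antisymm
  · rintro z ⟨hz, hz1⟩
    have hex : ∃ j : ℕ, ϖ ^ j * z ∈ L.integralAdjoin τ := by
      have hz' : z ∈ Algebra.adjoin L {τ} := by
        rw [← IntermediateField.adjoin_simple_toSubalgebra_of_isAlgebraic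
          (Algebra.IsAlgebraic.isAlgebraic τ)]
        exact hz
      clear hz hz1
      induction hz' using Algebra.adjoin_induction with
      | mem x hx =>
        rw [Set.mem_singleton_iff] at hx
        exact ⟨0, by simpa [hx] using L.self_mem_integralAdjoin τ⟩
      | algebraMap r =>
        obtain ⟨j, hj⟩ := hϖ.exists_norm_pow_mul_le_one (r : K)
        exact ⟨j, L.unitBall_subset_integralAdjoin τ ⟨L.mul_mem (L.pow_mem hL.mem j) r.2, hj⟩⟩
      | add x y _ _ hx hy =>
        obtain ⟨i, hi⟩ := hx
        obtain ⟨j, hj⟩ := hy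
        refine ⟨i + j, ?_⟩
        have := add_mem (mul_mem (hunit j) hi) (mul_mem (hunit i) hj)
        convert this using 1
        ring
      | mul x y _ _ hx hy =>
        obtain ⟨i, hi⟩ := hx
        obtain ⟨j, hj⟩ := hy
        refine ⟨i + j, ?_⟩
        have := mul_mem hi hj
        convert this using 1
        ring
    obtain ⟨j, hj⟩ := hex
    induction j with
    | zero => simpa using hj
    | succ j ih =>
      apply ih
      have h1 : ‖ϖ ^ (j + 1) * z‖ < 1 := by
        rw [pow_succ', mul_assoc]
        refine hϖ.norm_mul_lt_one ?_
        rw [norm_mul, norm_pow]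
        exact mul_le_one₀ (pow_le_one₀ (norm_nonneg _) hϖ.norm_lt_one.le) (norm_nonneg _) hz1
      have := div_mem_integralAdjoin hϖ hL hf hk hτ1 hτ hj h1
      rwa [pow_succ', mul_assoc, mul_div_cancel_left₀ _ hϖ.ne_zero] at this
  · set S : Subring K := (L.adjoinSimple τ).toSubring ⊓ (integers p K).toSubring
    have hS : L.integralAdjoin τ ≤ S := by
      refine integralAdjoin_le ⟨self_mem_adjoinSimple, (mem_integers p).2 hτ1⟩ fun a ha => ?_
      exact ⟨le_adjoinSimple ha.1, (mem_integers p).2 ha.2⟩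
    exact fun z hz => ⟨(hS hz).1, (mem_integers p).1 (hS hz).2⟩

theorem IsClosedFiniteWith.adjoinSimple (hϖ : IsMaximalNormLTOne ϖ) [ProperSpace K]
    (hL : L.IsClosedFiniteWith ϖ) : (L.adjoinSimple τ).IsClosedFiniteWith ϖ := by
  have := hL.finite
  have := properSpace_of_isClosed hL.isClosed
  refine ⟨?_, le_adjoinSimple hL.mem, ?_⟩
  · let := L.nontriviallyNormedField hϖ hL.mem
    let := L.normedAlgebra
    exact Submodule.closed_of_finiteDimensional
      (IntermediateField.adjoin L {τ}).toSubalgebra.toSubmodule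
  · exact Module.Finite.of_restrictScalars_finite L (IntermediateField.adjoin L {τ}) K

theorem finrank_adjoinSimple_mul (L : Subfield K) (τ : K) :
    Module.finrank L (IntermediateField.adjoin L {τ}) * Module.finrank (L.adjoinSimple τ) K =
      Module.finrank L K :=
  Module.finrank_mul_finrank L (IntermediateField.adjoin L {τ}) K

end Teichmuller

end Subfield

/-! ### Residue degrees, and the volume on a residue class. -/

namespace Subfield

variable {p : ℕ} [Fact p.Prime] {K : Type*} [NormedField K] [NormedAlgebra ℚ_[p] K]
  {ϖ : K} {L : Subfield K}

open PAdicField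

/-- The degree of a residue class over the residue field of a subfield, as the length of its orbit
under Frobenius. -/
noncomputable def residueDegree (L : Subfield K) (c : IsLocalRing.ResidueField (integers p K)) :
    ℕ :=
  Function.minimalPeriod (· ^ Nat.card (L.residueSubring p)) c

theorem residueDegree_dvd_iff {c : IsLocalRing.ResidueField (integers p K)} {k : ℕ} :
    L.residueDegree c ∣ k ↔ c ^ Nat.card (L.residueSubring p) ^ k = c := by
  rw [residueDegree, ← Function.isPeriodicPt_iff_minimalPeriod_dvd, Function.IsPeriodicPt,
    Function.IsFixedPt, pow_iterate]

variable [FiniteDimensional ℚ_[p] K]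

/-- The subfield generated by the Teichmüller representative of a residue class. -/
noncomputable def adjoinTeichmuller (L : Subfield K)
    (c : IsLocalRing.ResidueField (integers p K)) : Subfield K :=
  L.adjoinSimple (teichmuller c : K)

theorem IsClosedFiniteWith.adjoinTeichmuller (hϖ : IsMaximalNormLTOne ϖ)
    (hL : L.IsClosedFiniteWith ϖ) (c : IsLocalRing.ResidueField (integers p K)) :
    (L.adjoinTeichmuller c).IsClosedFiniteWith ϖ :=
  have := properSpace p K
  hL.adjoinSimple hϖ

theorem teichmuller_pow_card_pow_residueDegree (L : Subfield K)
    (c : IsLocalRing.ResidueField (integers p K)) :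
    (teichmuller c : K) ^ Nat.card (L.residueSubring p) ^ L.residueDegree c = teichmuller c :=
  teichmuller_pow_eq_self (residueDegree_dvd_iff.1 dvd_rfl)

section Degree

variable [MeasurableSpace K] [BorelSpace K]

theorem exists_card_residueSubring_eq_pow (hϖ : IsMaximalNormLTOne ϖ)
    (hL : L.IsClosedFiniteWith ϖ) : ∃ f : ℕ, Nat.card (L.residueSubring p) = p ^ f := by
  have := hL.finite
  have h := card_residueSubring_pow_finrank (p := p) hϖ hL
  obtain ⟨F, hF⟩ := exists_residueCard_eq_pow (p := p) (K := K)
  rw [hF] at h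
  have hdvd : Nat.card (L.residueSubring p) ∣ p ^ F := by
    rw [← h]
    exact dvd_pow_self _ Module.finrank_pos.ne'
  obtain ⟨f, -, hf⟩ := (Nat.dvd_prime_pow (Fact.out : p.Prime)).1 hdvd
  exact ⟨f, hf⟩

theorem residueDegree_dvd_finrank (hϖ : IsMaximalNormLTOne ϖ) (hL : L.IsClosedFiniteWith ϖ)
    (c : IsLocalRing.ResidueField (integers p K)) : L.residueDegree c ∣ Module.finrank L K := by
  rw [residueDegree_dvd_iff, card_residueSubring_pow_finrank hϖ hL]
  exact residue_pow_residueCard c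

theorem residueDegree_ne_zero (hϖ : IsMaximalNormLTOne ϖ) (hL : L.IsClosedFiniteWith ϖ)
    (c : IsLocalRing.ResidueField (integers p K)) : L.residueDegree c ≠ 0 := by
  have := hL.finite
  intro h
  have := residueDegree_dvd_finrank hϖ hL c
  rw [h, zero_dvd_iff] at this
  exact Module.finrank_pos.ne' this

theorem unitBall_adjoinTeichmuller (hϖ : IsMaximalNormLTOne ϖ) (hL : L.IsClosedFiniteWith ϖ)
    (c : IsLocalRing.ResidueField (integers p K)) :
    (L.adjoinTeichmuller c).unitBall = L.integralAdjoin (teichmuller c : K) := by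
  obtain ⟨f, hf⟩ := exists_card_residueSubring_eq_pow (p := p) hϖ hL
  exact unitBall_adjoinSimple hϖ hL hf (residueDegree_ne_zero hϖ hL c)
    (norm_teichmuller_le_one c) (teichmuller_pow_card_pow_residueDegree L c)

/-- The valuation ring of `L(τ)` is `𝒪_L[τ]`, where `a ^ N ≡ a` modulo `ϖ`; so all its residues are
roots of `X ^ N - X`. -/
theorem card_residueSubring_adjoinTeichmuller_le (hϖ : IsMaximalNormLTOne ϖ)
    (hL : L.IsClosedFiniteWith ϖ) (c : IsLocalRing.ResidueField (integers p K)) :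
    Nat.card ((L.adjoinTeichmuller c).residueSubring p) ≤
      Nat.card (L.residueSubring p) ^ L.residueDegree c := by
  classical
  obtain ⟨f, hf⟩ := exists_card_residueSubring_eq_pow (p := p) hϖ hL
  have := Fintype.ofFinite ((L.adjoinTeichmuller c).residueSubring p)
  set N := Nat.card (L.residueSubring p) ^ L.residueDegree c
  have hN : 1 < N := one_lt_pow₀ one_lt_card_residueSubring (residueDegree_ne_zero hϖ hL c)
  have hfix : ∀ b ∈ (L.adjoinTeichmuller c).residueSubring p, b ^ N = b := by
    intro b hb
    obtain ⟨a, ha, rfl⟩ := mem_residueSubring.1 hb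
    have ha' : (a : K) ∈ (L.adjoinTeichmuller c).unitBall := ⟨ha, (mem_integers p).1 a.2⟩
    have ha2 := ha'
    rw [unitBall_adjoinTeichmuller hϖ hL c] at ha2
    obtain ⟨w, hw, hwa⟩ := exists_pow_sub_self_eq_mul hϖ hL.mem hf
      (teichmuller_pow_card_pow_residueDegree L c) ha2
    rw [← map_pow, residue_eq_residue_iff]
    change ‖(a : K) ^ N - a‖ < 1
    rw [hwa]
    have hw2 : w ∈ ((L.integralAdjoin (teichmuller c : K) : Subring K) : Set K) := hw
    rw [← unitBall_adjoinTeichmuller hϖ hL c] at hw2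
    exact hϖ.norm_mul_lt_one hw2.2
  rw [Nat.card_eq_fintype_card, ← Finset.card_univ,
    ← Finset.card_map (Function.Embedding.subtype _),
    ← FiniteField.X_pow_card_sub_X_natDegree_eq (IsLocalRing.ResidueField (integers p K)) hN]
  refine Polynomial.card_le_degree_of_subset_roots (Multiset.subset_iff.2 fun b hb => ?_)
  rw [Polynomial.mem_roots (FiniteField.X_pow_card_sub_X_ne_zero _ hN)]
  simp only [Finset.mem_val, Finset.mem_map, Finset.mem_univ, true_and] at hb
  obtain ⟨x, rfl⟩ := hb
  simpa [sub_eq_zero] using hfix x x.2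

/-- Let `e = [L(τ) : L]`. Expressing `Q` over `L` and over `L(τ)` shows that `L(τ)` has residue
cardinality `q ^ e`. As `c` lies in that residue ring, its degree divides `e`; the cardinality bound
gives the reverse inequality. -/
theorem finrank_and_card_adjoinTeichmuller (hϖ : IsMaximalNormLTOne ϖ)
    (hL : L.IsClosedFiniteWith ϖ) (c : IsLocalRing.ResidueField (integers p K)) :
    L.residueDegree c * Module.finrank (L.adjoinTeichmuller c) K = Module.finrank L K ∧
    Nat.card ((L.adjoinTeichmuller c).residueSubring p) =
      Nat.card (L.residueSubring p) ^ L.residueDegree c := by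
  have hL' := hL.adjoinTeichmuller hϖ c
  have := hL.finite
  have := hL'.finite
  have hle := card_residueSubring_adjoinTeichmuller_le hϖ hL c
  have h1 := finrank_adjoinSimple_mul L (teichmuller c : K)
  change _ * Module.finrank (L.adjoinTeichmuller c) K = _ at h1
  set e := Module.finrank L (IntermediateField.adjoin L {(teichmuller c : K)})
  have hm' : Module.finrank (L.adjoinTeichmuller c) K ≠ 0 := Module.finrank_pos.ne'
  have h2 := card_residueSubring_pow_finrank (p := p) hϖ hL
  rw [← card_residueSubring_pow_finrank (p := p) hϖ hL', ← h1, pow_mul] at h2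
  have h3 := Nat.pow_left_injective hm' h2
  have hde : L.residueDegree c ∣ e := by
    rw [residueDegree_dvd_iff, h3]
    exact residueSubring_pow_card (mem_residueSubring.2
      ⟨teichmuller c, self_mem_adjoinSimple, residue_teichmuller c⟩)
  have he : e = L.residueDegree c := by
    refine le_antisymm ?_ (Nat.le_of_dvd ?_ hde)
    · rw [← h3] at hle
      exact (Nat.pow_le_pow_iff_right one_lt_card_residueSubring).1 hle
    · rw [Nat.pos_iff_ne_zero]
      intro h0
      rw [h0, zero_mul] at h1
      exact Module.finrank_pos.ne h1
  exact ⟨by rw [← he, h1], by rw [← h3, he]⟩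

theorem adjoinTeichmuller_eq_self (hϖ : IsMaximalNormLTOne ϖ) (hL : L.IsClosedFiniteWith ϖ)
    {c : IsLocalRing.ResidueField (integers p K)} (hc : L.residueDegree c = 1) :
    L.adjoinTeichmuller c = L := by
  have := hL.finite
  have := (hL.adjoinTeichmuller hϖ c).finite
  have h1 := finrank_adjoinSimple_mul L (teichmuller c : K)
  have h2 := (finrank_and_card_adjoinTeichmuller hϖ hL c).1
  rw [hc, one_mul] at h2
  change _ * Module.finrank (L.adjoinTeichmuller c) K = _ at h1
  rw [h2] at h1
  have h3 : Module.finrank L (IntermediateField.adjoin L {(teichmuller c : K)}) = 1 :=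
    Nat.eq_of_mul_eq_mul_right Module.finrank_pos (by rw [h1, one_mul])
  have h4 := IntermediateField.finrank_eq_one_iff.1 h3
  refine le_antisymm (fun x hx => ?_) le_adjoinSimple
  have hx' : x ∈ IntermediateField.adjoin L {(teichmuller c : K)} := hx
  rw [h4] at hx'
  obtain ⟨y, rfl⟩ := IntermediateField.mem_bot.1 hx'
  exact y.2

/-- The point is that `τ ∈ 𝒪_L[x]` for `x = τ + ϖ y`: it is the limit of the powers `x ^ Q ^ k` and
the ring is closed. Then `ϖ y = x - τ` and `𝒪_{L(τ)} = 𝒪_L[τ]` lie in it too. -/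
theorem integralAdjoin_teichmuller_add (hϖ : IsMaximalNormLTOne ϖ) (hL : L.IsClosedFiniteWith ϖ)
    (c : IsLocalRing.ResidueField (integers p K)) {y : K} (hy : ‖y‖ ≤ 1) :
    L.integralAdjoin (teichmuller c + ϖ * y) =
      (L.adjoinTeichmuller c).integralAdjoin (ϖ * y) := by
  have := isUltrametricDist p K
  have := properSpace p K
  have hball := unitBall_adjoinTeichmuller hϖ hL c
  set x := (teichmuller c : K) + ϖ * y
  have hxτ : ‖x - teichmuller c‖ < 1 := by
    rw [add_sub_cancel_left]
    exact hϖ.norm_mul_lt_one hy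
  have hx1 : ‖x‖ ≤ 1 := (IsUltrametricDist.norm_add_le_max _ _).trans
    (max_le (norm_teichmuller_le_one c) (hϖ.norm_mul_lt_one hy).le)
  have hτ' : (teichmuller c : K) ∈ (L.adjoinTeichmuller c).unitBall :=
    ⟨self_mem_adjoinSimple, norm_teichmuller_le_one c⟩
  apply le_antisymm
  · refine integralAdjoin_le (add_mem (unitBall_subset_integralAdjoin _ _ hτ')
      (self_mem_integralAdjoin _ _)) fun a ha => ?_
    exact unitBall_subset_integralAdjoin _ _ ⟨le_adjoinSimple ha.1, ha.2⟩
  · have hτ : (teichmuller c : K) ∈ L.integralAdjoin x := by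
      have hclosed := (isCompact_integralAdjoin hϖ hL hx1).isClosed
      have hpow : ∀ k : ℕ, (teichmuller c : K) ^ residueCard p K ^ k = teichmuller c := by
        intro k
        induction k with
        | zero => simp
        | succ k ih => rw [pow_succ, pow_mul, ih, teichmuller_pow_residueCard]
      have hlim : Tendsto (fun k : ℕ => x ^ residueCard p K ^ k) atTop
          (𝓝 (teichmuller c : K)) := by
        rw [tendsto_iff_norm_sub_tendsto_zero]
        refine squeeze_zero (fun _ => norm_nonneg _) (fun k => ?_)
          ((tendsto_pow_atTop_nhds_zero_of_lt_one hϖ.norm_pos.le hϖ.norm_lt_one).comp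
            (tendsto_add_atTop_nat 1))
        have := norm_pow_residueCard_pow_sub_le (p := p) hϖ hx1 (norm_teichmuller_le_one c) hxτ k
        rwa [hpow] at this
      exact hclosed.mem_of_tendsto hlim
        (Eventually.of_forall fun k => pow_mem (self_mem_integralAdjoin L x) _)
    refine integralAdjoin_le ?_ ?_
    · have := sub_mem (self_mem_integralAdjoin L x) hτ
      rwa [add_sub_cancel_left] at this
    · rw [hball]
      exact integralAdjoin_le hτ (unitBall_subset_integralAdjoin L x)

variable (p) in
/-- The Haar measure of the ring generated by an element over the unit ball of a subfield. -/
noncomputable def adjoinVolume (L : Subfield K) (x : K) : ℝ :=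
  (haar p K).real (L.integralAdjoin x)

theorem adjoinVolume_teichmuller_add (hϖ : IsMaximalNormLTOne ϖ) (hL : L.IsClosedFiniteWith ϖ)
    (c : IsLocalRing.ResidueField (integers p K)) {y : K} (hy : ‖y‖ ≤ 1) :
    L.adjoinVolume p (teichmuller c + ϖ * y) =
      ((Nat.card ((L.adjoinTeichmuller c).residueSubring p) : ℝ) ^
        (∑ i ∈ Finset.range (Module.finrank (L.adjoinTeichmuller c) K), i))⁻¹ *
      (L.adjoinTeichmuller c).adjoinVolume p y := by
  have hL' := hL.adjoinTeichmuller hϖ c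
  rw [adjoinVolume, integralAdjoin_teichmuller_add hϖ hL c hy, adjoinVolume,
    ← measureReal_integralAdjoin_mul hϖ hL' one_lt_card_residueSubring hy, inv_mul_cancel_left₀]
  have : 0 < Nat.card ((L.adjoinTeichmuller c).residueSubring p) := Nat.card_pos
  positivity

theorem adjoinVolume_nonneg (x : K) : 0 ≤ L.adjoinVolume p x := measureReal_nonneg

theorem adjoinVolume_le_one {x : K} (hx : ‖x‖ ≤ 1) : L.adjoinVolume p x ≤ 1 := by
  have hsub : (L.integralAdjoin x : Set K) ⊆ integers p K := by
    have : L.integralAdjoin x ≤ (integers p K).toSubring :=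
      integralAdjoin_le ((mem_integers p).2 hx) fun a ha => (mem_integers p).2 ha.2
    exact this
  have h : haar p K (integers p K : Set K) = 1 := haar_integers
  have h2 := measureReal_mono (μ := haar p K) hsub (by rw [h]; exact ENNReal.one_ne_top)
  rwa [measureReal_def (haar p K) (integers p K : Set K), h, ENNReal.toReal_one] at h2

end Degree

end Subfield

/-! ### Counting residue classes by degree, and integrability. -/

/-- Besides `0`, the solutions are the `(q ^ k - 1)`-torsion of the cyclic group `κˣ`, whose order
`q ^ m - 1` is a multiple of `q ^ k - 1`. -/
theorem card_filter_pow_card_pow_eq_self {κ : Type*} [Field κ] [Fintype κ] [DecidableEq κ]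
    {q m k : ℕ} (hq : 1 < q) (hκ : Fintype.card κ = q ^ m) (hk : k ∣ m) (hk0 : k ≠ 0) :
    (Finset.univ.filter fun c : κ => c ^ q ^ k = c).card = q ^ k := by
  have hN : 1 < q ^ k := one_lt_pow₀ hq hk0
  have hker := IsCyclic.card_powMonoidHom_ker (G := κˣ) (q ^ k - 1)
  have hcard : Nat.card κˣ = q ^ m - 1 := by
    rw [Nat.card_units, Nat.card_eq_fintype_card, hκ]
  have hdvd : q ^ k - 1 ∣ q ^ m - 1 := by
    obtain ⟨j, rfl⟩ := hk
    rw [pow_mul]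
    simpa using Nat.sub_dvd_pow_sub_pow (q ^ k) 1 j
  rw [hcard, Nat.gcd_eq_right hdvd] at hker
  have hunits : ∀ u : κˣ, u ∈ (powMonoidHom (q ^ k - 1) : κˣ →* κˣ).ker ↔
      (u : κ) ^ q ^ k = u := by
    intro u
    rw [MonoidHom.mem_ker, powMonoidHom_apply, Units.ext_iff, Units.val_pow_eq_pow_val,
      Units.val_one]
    have h : (u : κ) ^ q ^ k = (u : κ) ^ (q ^ k - 1) * u := by
      rw [← pow_succ, Nat.sub_add_cancel hN.le]
    rw [h]
    exact (mul_eq_right₀ u.ne_zero).symm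
  have hset : (Finset.univ.filter fun c : κ => c ^ q ^ k = c) =
      insert 0 ((Finset.univ.filter fun u : κˣ =>
        u ∈ (powMonoidHom (q ^ k - 1) : κˣ →* κˣ).ker).map ⟨Units.val, Units.val_injective⟩) := by
    ext c
    simp only [Finset.mem_filter, Finset.mem_univ, true_and, Finset.mem_insert, Finset.mem_map,
      hunits, Function.Embedding.coeFn_mk]
    constructor
    · intro hc
      by_cases h0 : c = 0
      · exact Or.inl h0
      · exact Or.inr ⟨Units.mk0 c h0, hc, rfl⟩
    · rintro (rfl | ⟨u, hu, rfl⟩)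
      · exact zero_pow (by omega)
      · exact hu
  rw [hset, Finset.card_insert_of_notMem (by simp), Finset.card_map,
    ← Fintype.card_subtype, ← Nat.card_eq_fintype_card]
  have h1 : Nat.card {u : κˣ // u ∈ (powMonoidHom (q ^ k - 1) : κˣ →* κˣ).ker} = q ^ k - 1 := hker
  rw [h1]
  omega

namespace Subfield

variable {p : ℕ} [Fact p.Prime] {K : Type*} [NormedField K] [NormedAlgebra ℚ_[p] K]
  [FiniteDimensional ℚ_[p] K] {ϖ : K} {L : Subfield K}

open PAdicField

theorem norm_le_one_of_mem_integralAdjoin [IsUltrametricDist K] {x z : K} (hx : ‖x‖ ≤ 1)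
    (hz : z ∈ L.integralAdjoin x) : ‖z‖ ≤ 1 := by
  have : L.integralAdjoin x ≤ normLEOneSubring K := integralAdjoin_le hx fun a ha => ha.2
  exact this hz

theorem exists_mem_integralAdjoin_norm_sub_le [IsUltrametricDist K] {x y z : K} (hx : ‖x‖ ≤ 1)
    (hy : ‖y‖ ≤ 1) (hz : z ∈ L.integralAdjoin x) :
    ∃ w ∈ L.integralAdjoin y, ‖z - w‖ ≤ ‖x - y‖ := by
  induction hz using Subring.closure_induction with
  | mem z hz =>
    rcases hz with rfl | hz
    · exact ⟨y, L.self_mem_integralAdjoin y, le_rfl⟩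
    · exact ⟨z, L.unitBall_subset_integralAdjoin y hz, by simp⟩
  | zero => exact ⟨0, zero_mem _, by simp⟩
  | one => exact ⟨1, one_mem _, by simp⟩
  | add a b _ _ ha hb =>
    obtain ⟨a', ha', haa⟩ := ha
    obtain ⟨b', hb', hbb⟩ := hb
    refine ⟨a' + b', add_mem ha' hb', ?_⟩
    rw [add_sub_add_comm]
    exact (IsUltrametricDist.norm_add_le_max _ _).trans (max_le haa hbb)
  | neg a _ ha =>
    obtain ⟨a', ha', haa⟩ := ha
    refine ⟨-a', neg_mem ha', ?_⟩
    rwa [neg_sub_neg, norm_sub_rev]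
  | mul a b ha hb iha ihb =>
    obtain ⟨a', ha', haa⟩ := iha
    obtain ⟨b', hb', hbb⟩ := ihb
    refine ⟨a' * b', mul_mem ha' hb', ?_⟩
    have : a * b - a' * b' = a * (b - b') + (a - a') * b' := by ring
    rw [this]
    refine (IsUltrametricDist.norm_add_le_max _ _).trans (max_le ?_ ?_)
    · rw [norm_mul]
      exact (mul_le_of_le_one_left (norm_nonneg _)
        (norm_le_one_of_mem_integralAdjoin hx ha)).trans hbb
    · rw [norm_mul]
      exact (mul_le_of_le_one_right (norm_nonneg _)
        (norm_le_one_of_mem_integralAdjoin hy hb')).trans haa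

theorem cthickening_integralAdjoin_subset [IsUltrametricDist K] [ProperSpace K]
    (hϖ : IsMaximalNormLTOne ϖ) (hL : L.IsClosedFiniteWith ϖ) {x y : K} (hx : ‖x‖ ≤ 1)
    (hy : ‖y‖ ≤ 1) {δ : ℝ} (hδ : 0 ≤ δ) (hxy : ‖x - y‖ ≤ δ) :
    Metric.cthickening δ (L.integralAdjoin x : Set K) ⊆
      Metric.cthickening δ (L.integralAdjoin y : Set K) := by
  rw [(isCompact_integralAdjoin hϖ hL hx).cthickening_eq_biUnion_closedBall hδ,
    (isCompact_integralAdjoin hϖ hL hy).cthickening_eq_biUnion_closedBall hδ]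
  intro z hz
  simp only [Set.mem_iUnion, Metric.mem_closedBall, dist_eq_norm, exists_prop] at hz ⊢
  obtain ⟨a, ha, hza⟩ := hz
  obtain ⟨b, hb, hab⟩ := exists_mem_integralAdjoin_norm_sub_le hx hy ha
  refine ⟨b, hb, ?_⟩
  rw [← sub_add_sub_cancel z a b]
  exact (IsUltrametricDist.norm_add_le_max _ _).trans (max_le hza (hab.trans hxy))

variable [MeasurableSpace K] [BorelSpace K]

/-- Moving `x` by at most `δ` does not change the closed `δ`-thickening of `𝒪_L[x]`, so its volume
is locally constant on `𝒪_K`. As `δ → 0` these volumes converge to that of the compact ring. -/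
theorem aemeasurable_adjoinVolume (hϖ : IsMaximalNormLTOne ϖ) (hL : L.IsClosedFiniteWith ϖ) :
    AEMeasurable (L.adjoinVolume p) ((haar p K).restrict (integers p K)) := by
  have := isUltrametricDist p K
  have := properSpace p K
  have hpos : ∀ k : ℕ, 0 < ‖ϖ‖ ^ k := fun k => pow_pos hϖ.norm_pos k
  have hcont : ∀ k : ℕ, AEMeasurable (fun x => (haar p K).real
      (Metric.cthickening (‖ϖ‖ ^ k) (L.integralAdjoin x : Set K)))
      ((haar p K).restrict (integers p K)) := by
    intro k
    refine ContinuousOn.aemeasurable (fun x hx => ?_) measurableSet_integers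
    have hx1 := (mem_integers p).1 hx
    refine (continuousWithinAt_const (b := (haar p K).real
      (Metric.cthickening (‖ϖ‖ ^ k) (L.integralAdjoin x : Set K)))).congr_of_eventuallyEq ?_ rfl
    filter_upwards [self_mem_nhdsWithin,
      mem_nhdsWithin_of_mem_nhds (Metric.closedBall_mem_nhds x (hpos k))] with y hy hyx
    rw [Metric.mem_closedBall, dist_eq_norm] at hyx
    have hy1 := (mem_integers p).1 hy
    congr 1
    refine Set.Subset.antisymm
      (cthickening_integralAdjoin_subset hϖ hL hy1 hx1 (hpos k).le hyx)
      (cthickening_integralAdjoin_subset hϖ hL hx1 hy1 (hpos k).le ?_)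
    rwa [norm_sub_rev]
  refine aemeasurable_of_tendsto_metrizable_ae atTop hcont ?_
  refine (ae_restrict_iff' measurableSet_integers).2 (Eventually.of_forall fun x hx => ?_)
  have hc := isCompact_integralAdjoin hϖ hL ((mem_integers p).1 hx)
  have h := (tendsto_measure_cthickening_of_isCompact (μ := haar p K) hc).comp
    (tendsto_pow_atTop_nhds_zero_of_lt_one hϖ.norm_pos.le hϖ.norm_lt_one)
  exact (ENNReal.tendsto_toReal hc.measure_ne_top).comp h

theorem integrableOn_adjoinVolume_cpow (hϖ : IsMaximalNormLTOne ϖ) (hL : L.IsClosedFiniteWith ϖ)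
    {r : ℂ} (hr : 0 < r.re) :
    IntegrableOn (fun x => (L.adjoinVolume p x : ℂ) ^ r) (integers p K) (haar p K) := by
  have hfin : haar p K (integers p K : Set K) ≠ ⊤ := by
    rw [haar_integers]
    exact ENNReal.one_ne_top
  have hmeas : AEMeasurable (fun x => (L.adjoinVolume p x : ℂ) ^ r)
      ((haar p K).restrict (integers p K)) :=
    (Complex.measurable_ofReal.comp_aemeasurable (aemeasurable_adjoinVolume hϖ hL)).pow_const r
  have : IsFiniteMeasure ((haar p K).restrict (integers p K)) :=
    isFiniteMeasure_restrict.2 hfin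
  refine Integrable.of_bound hmeas.aestronglyMeasurable 1 ?_
  refine (ae_restrict_iff' measurableSet_integers).2 (Eventually.of_forall fun x hx => ?_)
  -- The volume may vanish, so the norm formula for the power needs `r.re ≠ 0`.
  rw [Complex.norm_cpow_eq_rpow_re_of_nonneg (adjoinVolume_nonneg x) hr.ne']
  exact Real.rpow_le_one (adjoinVolume_nonneg x)
    (adjoinVolume_le_one ((mem_integers p).1 hx)) hr.le

-- Summing over `d ∣ k` counts the solutions of `c ^ q ^ k = c`, of which there are `q ^ k`; Möbius
-- inversion, restricted to the divisors of `[K : L]`, does the rest.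
open scoped Classical in
theorem card_residueDegree_eq (hϖ : IsMaximalNormLTOne ϖ) (hL : L.IsClosedFiniteWith ϖ)
    [Fintype (IsLocalRing.ResidueField (integers p K))] {d : ℕ} (hd : d ∣ Module.finrank L K) :
    ((Finset.univ.filter fun c : IsLocalRing.ResidueField (integers p K) =>
      L.residueDegree c = d).card : ℂ) =
      ∑ e ∈ d.divisors, (ArithmeticFunction.moebius (d / e) : ℂ) *
        (Nat.card (L.residueSubring p) : ℂ) ^ e := by
  have := hL.finite
  have hm : Module.finrank L K ≠ 0 := Module.finrank_pos.ne'
  have hq := one_lt_card_residueSubring (p := p) (L := L)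
  have hκ : Fintype.card (IsLocalRing.ResidueField (integers p K)) =
      Nat.card (L.residueSubring p) ^ Module.finrank L K := by
    rw [card_residueSubring_pow_finrank hϖ hL, residueCard, Nat.card_eq_fintype_card]
  have hd0 : 0 < d := Nat.pos_of_ne_zero (ne_zero_of_dvd_ne_zero hm hd)
  have key := (ArithmeticFunction.sum_eq_iff_sum_mul_moebius_eq_on (R := ℂ)
    (f := fun d => ((Finset.univ.filter fun c : IsLocalRing.ResidueField (integers p K) =>
      L.residueDegree c = d).card : ℂ))
    (g := fun e => (Nat.card (L.residueSubring p) : ℂ) ^ e)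
    {k | k ∣ Module.finrank L K} (fun _ _ h1 h2 => h1.trans h2)).1 ?_ d hd0 hd
  · rw [← key, Nat.sum_divisorsAntidiagonal'
      (fun i j => (ArithmeticFunction.moebius i : ℂ) * (Nat.card (L.residueSubring p) : ℂ) ^ j)]
  · intro k hk0 hk
    rw [← Nat.cast_sum, ← Nat.cast_pow,
      ← card_filter_pow_card_pow_eq_self hq hκ hk hk0.ne']
    congr 1
    rw [Finset.card_eq_sum_card_fiberwise (f := L.residueDegree) (t := k.divisors)]
    · refine Finset.sum_congr rfl fun d hd => ?_
      congr 1
      ext c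
      simp only [Finset.mem_filter, Finset.mem_univ, true_and]
      refine ⟨fun h => ⟨residueDegree_dvd_iff.1 ?_, h⟩, fun h => h.2⟩
      rw [h]
      exact Nat.dvd_of_mem_divisors hd
    · intro c hc
      simp only [Finset.coe_filter, Finset.mem_univ, true_and, Set.mem_ofPred_eq] at hc
      exact Nat.mem_divisors.2 ⟨residueDegree_dvd_iff.2 hc, hk0.ne'⟩

end Subfield

/-! ### The recursion for the integral. -/

theorem natCast_pow_cpow (q n : ℕ) (s : ℂ) :
    ((q ^ n : ℕ) : ℂ) ^ s = (q : ℂ) ^ ((n : ℂ) * s) := by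
  rw [Complex.cpow_nat_mul]
  induction n with
  | zero => simp
  | succ n ih => rw [pow_succ, Nat.cast_mul, Complex.natCast_mul_natCast_cpow, ih, pow_succ]

/-- The exponent is `m (m - 1) / 2`, so one factor `m` is absorbed into `Q = q ^ m`. The resulting
base `Q ^ (-r/2)` is thus the same for all subfields. -/
theorem inv_pow_sum_range_cpow {q m Q : ℕ} (hQ : q ^ m = Q) (r : ℂ) :
    (((((q : ℝ) ^ (∑ i ∈ Finset.range m, i))⁻¹ : ℝ) : ℂ)) ^ r =
      ((Q : ℂ) ^ (-r / 2)) ^ (m - 1) := by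
  set S := ∑ i ∈ Finset.range m, i
  have hS : (S : ℂ) * 2 = m * ((m - 1 : ℕ) : ℂ) := by exact_mod_cast Finset.sum_range_id_mul_two m
  have h1 : ((((q : ℝ) ^ S)⁻¹ : ℝ) : ℂ) = (((q ^ S : ℕ) : ℂ))⁻¹ := by push_cast; rfl
  have harg : (((q ^ S : ℕ) : ℂ)).arg ≠ Real.pi := by
    rw [Complex.natCast_arg]
    exact Real.pi_pos.ne
  rw [h1, Complex.inv_cpow _ _ harg, natCast_pow_cpow q S, ← hQ, natCast_pow_cpow q m,
    ← Complex.cpow_neg, ← Complex.cpow_nat_mul]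
  congr 1
  linear_combination (-r / 2) * hS

theorem dFunction_eq_sum {m : ℕ} (hm : m ≠ 1) (u v : ℂ) :
    dFunction m u v = 1 / (u ^ (m - 1) - v ^ (m - 1)) * ∑ d ∈ m.divisors.erase 1,
      v ^ (m / d - 1) *
        (∑ e ∈ d.divisors, (ArithmeticFunction.moebius (d / e) : ℂ) * u ^ (e - 1)) *
        dFunction (m / d) (u ^ d) v := by
  rw [dFunction, if_neg hm, Finset.univ_eq_attach, Finset.sum_attach (m.divisors.erase 1)
    (fun d => v ^ (m / d - 1) *
        (∑ e ∈ d.divisors, (ArithmeticFunction.moebius (d / e) : ℂ) * u ^ (e - 1)) *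
        dFunction (m / d) (u ^ d) v)]

namespace Subfield

variable {p : ℕ} [Fact p.Prime] {K : Type*} [NormedField K] [NormedAlgebra ℚ_[p] K]
  [FiniteDimensional ℚ_[p] K] {ϖ : K} {L : Subfield K} [MeasurableSpace K] [BorelSpace K]

open PAdicField

variable (p) in
/-- The integral over the valuation ring of a power of the volume of `L.integralAdjoin x`. -/
noncomputable def zetaIntegral (L : Subfield K) (r : ℂ) : ℂ :=
  ∫ x in (integers p K : Set K), (L.adjoinVolume p x : ℂ) ^ r ∂(haar p K)

theorem residueCard_mul_zetaIntegral (hϖ : IsMaximalNormLTOne ϖ) (hL : L.IsClosedFiniteWith ϖ)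
    [Fintype (IsLocalRing.ResidueField (integers p K))] {r : ℂ} (hr : 0 < r.re) :
    (residueCard p K : ℂ) * L.zetaIntegral p r =
      ∑ c : IsLocalRing.ResidueField (integers p K),
        ((residueCard p K : ℂ) ^ (-r / 2)) ^ (Module.finrank L K / L.residueDegree c - 1) *
          (L.adjoinTeichmuller c).zetaIntegral p r := by
  have hQ : (residueCard p K : ℂ) ≠ 0 := by
    exact_mod_cast (one_lt_residueCard (p := p) (K := K)).ne_bot
  rw [zetaIntegral, setIntegral_integers_eq_sum hϖ (integrableOn_adjoinVolume_cpow hϖ hL hr),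
    mul_inv_cancel_left₀ hQ]
  refine Finset.sum_congr rfl fun c _ => ?_
  have hL' := hL.adjoinTeichmuller hϖ c
  obtain ⟨h1, -⟩ := finrank_and_card_adjoinTeichmuller hϖ hL c
  have hdiv : Module.finrank L K / L.residueDegree c = Module.finrank (L.adjoinTeichmuller c) K := by
    rw [← h1, Nat.mul_div_cancel_left _ (Nat.pos_of_ne_zero (residueDegree_ne_zero hϖ hL c))]
  rw [zetaIntegral, hdiv, ← inv_pow_sum_range_cpow
    (card_residueSubring_pow_finrank hϖ hL') r, ← integral_const_mul]
  refine setIntegral_congr_fun measurableSet_integers fun y hy => ?_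
  have hy1 := (mem_integers p).1 hy
  rw [adjoinVolume_teichmuller_add hϖ hL c hy1, Complex.ofReal_mul,
    Complex.mul_cpow_ofReal_nonneg (by positivity) (adjoinVolume_nonneg y)]

theorem zetaIntegral_eq_one (hm : Module.finrank L K = 1) (r : ℂ) : L.zetaIntegral p r = 1 := by
  have htop : ∀ x : K, x ∈ L := by
    intro x
    have h : x ∈ (⊥ : Subalgebra L K) := by
      rw [Subalgebra.bot_eq_top_of_finrank_eq_one hm]
      exact Algebra.mem_top
    obtain ⟨y, rfl⟩ := Algebra.mem_bot.1 h
    exact y.2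
  have hvol : Set.EqOn (fun x => (L.adjoinVolume p x : ℂ) ^ r) (fun _ => 1)
      (integers p K : Set K) := by
    intro x hx
    have hset : (L.integralAdjoin x : Set K) = integers p K := by
      refine Set.Subset.antisymm ?_ fun z hz => ?_
      · have : L.integralAdjoin x ≤ (integers p K).toSubring :=
          integralAdjoin_le hx fun a ha => (mem_integers p).2 ha.2
        exact this
      · exact L.unitBall_subset_integralAdjoin x ⟨htop z, (mem_integers p).1 hz⟩
    simp only [adjoinVolume, hset]
    rw [measureReal_def, haar_integers]
    simp
  rw [zetaIntegral, setIntegral_congr_fun measurableSet_integers hvol, setIntegral_const,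
    measureReal_def, haar_integers]
  simp

theorem zetaIntegral_eq_dFunction (hϖ : IsMaximalNormLTOne ϖ) {r : ℂ} (hr : 0 < r.re) (m : ℕ) :
    ∀ L : Subfield K, L.IsClosedFiniteWith ϖ → Module.finrank L K = m →
      L.zetaIntegral p r = dFunction m (Nat.card (L.residueSubring p) : ℂ)
        ((residueCard p K : ℂ) ^ (-r / 2)) := by
  classical
  induction m using Nat.strong_induction_on with
  | _ m ih =>
  intro L hL hm
  have := hL.finite
  have hm0 : m ≠ 0 := hm ▸ Module.finrank_pos.ne'
  by_cases hm1 : m = 1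
  · rw [zetaIntegral_eq_one (hm.trans hm1), dFunction, if_pos hm1]
  have := Fintype.ofFinite (IsLocalRing.ResidueField (integers p K))
  have hrec := residueCard_mul_zetaIntegral (p := p) hϖ hL hr
  set v : ℂ := (residueCard p K : ℂ) ^ (-r / 2)
  set q : ℕ := Nat.card (L.residueSubring p)
  have hq : 1 < q := one_lt_card_residueSubring
  have hq0 : (q : ℂ) ≠ 0 := by exact_mod_cast (zero_lt_one.trans hq).ne'
  have hv : ‖v‖ < 1 := by
    have hQ : 1 < residueCard p K := one_lt_residueCard
    rw [Complex.norm_natCast_cpow_of_pos (zero_lt_one.trans hQ)]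
    refine Real.rpow_lt_one_of_one_lt_of_neg (by exact_mod_cast hQ) ?_
    have : (-r / 2).re = -r.re / 2 := by simp
    rw [this]
    linarith
  -- The denominator cannot vanish because `‖v‖ < 1 < q` and `m > 1`; the first inequality uses
  -- `r.re > 0`.
  have hne : (q : ℂ) ^ (m - 1) - v ^ (m - 1) ≠ 0 := by
    intro h
    have h1 := congrArg norm (sub_eq_zero.1 h)
    rw [norm_pow, norm_pow, Complex.norm_natCast] at h1
    have h2 : ‖v‖ ^ (m - 1) < 1 := pow_lt_one₀ (norm_nonneg _) hv (by omega)
    have h3 : (1 : ℝ) < (q : ℝ) ^ (m - 1) := one_lt_pow₀ (by exact_mod_cast hq) (by omega)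
    linarith
  set I := L.zetaIntegral p r
  -- Classes of degree one give back the unknown `I`; all others fall under the induction
  -- hypothesis.
  have hterm : ∀ c : IsLocalRing.ResidueField (integers p K),
      v ^ (Module.finrank L K / L.residueDegree c - 1) * (L.adjoinTeichmuller c).zetaIntegral p r =
      (fun d => v ^ (m / d - 1) * if d = 1 then I else dFunction (m / d) ((q : ℂ) ^ d) v)
        (L.residueDegree c) := by
    intro c
    simp only
    rw [hm]
    congr 1
    split_ifs with hc
    · rw [adjoinTeichmuller_eq_self hϖ hL hc]
    · obtain ⟨h1, h2⟩ := finrank_and_card_adjoinTeichmuller hϖ hL c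
      have hd0 := residueDegree_ne_zero hϖ hL c
      have hdiv : Module.finrank (L.adjoinTeichmuller c) K = m / L.residueDegree c := by
        rw [← hm, ← h1, Nat.mul_div_cancel_left _ (Nat.pos_of_ne_zero hd0)]
      rw [ih _ (Nat.div_lt_self (Nat.pos_of_ne_zero hm0) (by omega)) _
        (hL.adjoinTeichmuller hϖ c) hdiv, h2, Nat.cast_pow]
  rw [Finset.sum_congr rfl fun c _ => hterm c,
    ← Finset.sum_fiberwise_of_maps_to (t := m.divisors) (g := L.residueDegree) (fun c _ =>
      Nat.mem_divisors.2 ⟨hm ▸ residueDegree_dvd_finrank hϖ hL c, hm0⟩)] at hrec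
  -- A factor `q` is taken out of the count, which turns `q ^ e` into the `u ^ (e - 1)` of the
  -- recursion; it is cancelled against `Q = q * q ^ (m - 1)`.
  have hN : ∀ d ∈ m.divisors, ∑ c ∈ Finset.univ.filter
        (fun c : IsLocalRing.ResidueField (integers p K) => L.residueDegree c = d),
      (fun d => v ^ (m / d - 1) * if d = 1 then I else dFunction (m / d) ((q : ℂ) ^ d) v)
        (L.residueDegree c) =
      q * (∑ e ∈ d.divisors, (ArithmeticFunction.moebius (d / e) : ℂ) * (q : ℂ) ^ (e - 1)) *
        (v ^ (m / d - 1) * if d = 1 then I else dFunction (m / d) ((q : ℂ) ^ d) v) := by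
    intro d hd
    rw [Finset.sum_congr rfl (g := fun _ =>
      v ^ (m / d - 1) * if d = 1 then I else dFunction (m / d) ((q : ℂ) ^ d) v) (fun c hc => by
        rw [(Finset.mem_filter.1 hc).2]), Finset.sum_const, nsmul_eq_mul,
      card_residueDegree_eq hϖ hL (hm ▸ Nat.dvd_of_mem_divisors hd), Finset.mul_sum]
    congr 1
    refine Finset.sum_congr rfl fun e he => ?_
    have he0 : 0 < e := Nat.pos_of_mem_divisors he
    rw [mul_left_comm, ← pow_succ', Nat.sub_add_cancel he0]
  rw [Finset.sum_congr rfl hN, ← Finset.add_sum_erase _ _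
    (Nat.mem_divisors.2 ⟨one_dvd m, hm0⟩)] at hrec
  rw [dFunction_eq_sum hm1, one_div, eq_inv_mul_iff_mul_eq₀ hne]
  refine mul_left_cancel₀ hq0 ?_
  rw [Finset.mul_sum]
  have hrest : ∑ d ∈ m.divisors.erase 1, q *
      (∑ e ∈ d.divisors, (ArithmeticFunction.moebius (d / e) : ℂ) * (q : ℂ) ^ (e - 1)) *
        (v ^ (m / d - 1) * if d = 1 then I else dFunction (m / d) ((q : ℂ) ^ d) v) =
      ∑ d ∈ m.divisors.erase 1, (q : ℂ) * (v ^ (m / d - 1) *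
        (∑ e ∈ d.divisors, (ArithmeticFunction.moebius (d / e) : ℂ) * (q : ℂ) ^ (e - 1)) *
        dFunction (m / d) ((q : ℂ) ^ d) v) := by
    refine Finset.sum_congr rfl fun d hd => ?_
    rw [if_neg (Finset.mem_erase.1 hd).1]
    ring
  rw [← hrest]
  have hQq : (residueCard p K : ℂ) = q * (q : ℂ) ^ (m - 1) := by
    rw [← card_residueSubring_pow_finrank (p := p) hϖ hL, hm, ← pow_succ',
      Nat.sub_add_cancel (Nat.pos_of_ne_zero hm0)]
    push_cast
    rfl
  rw [hQq] at hrec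
  simp only [Nat.divisors_one, Finset.sum_singleton, Nat.div_one, if_true,
    ArithmeticFunction.moebius_apply_one, Nat.sub_self, pow_zero, Int.cast_one, mul_one] at hrec
  linear_combination hrec

end Subfield

/-! ### From the extension `K / F` to the image of `F` in `K`. -/

namespace PAdicField

variable {p : ℕ} [Fact p.Prime] {F K : Type*} [NormedField F] [NormedAlgebra ℚ_[p] F]
  [NormedField K] [NormedAlgebra F K]

theorem image_integers_eq_unitBall :
    algebraMap F K '' (integers p F : Set F) = (algebraMap F K).fieldRange.unitBall := by
  ext x
  constructor
  · rintro ⟨y, hy, rfl⟩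
    exact ⟨⟨y, rfl⟩, (norm_algebraMap' K y).le.trans ((mem_integers p).1 hy)⟩
  · rintro ⟨⟨y, rfl⟩, hy⟩
    exact ⟨y, (mem_integers p).2 ((norm_algebraMap' K y).symm.le.trans hy), rfl⟩

theorem coe_adjoin_integers (x : K) :
    (Algebra.adjoin (integers p F) {x} : Set K) =
      (algebraMap F K).fieldRange.integralAdjoin x := by
  have hmap : ∀ a : integers p F, algebraMap (integers p F) K a = algebraMap F K a := fun a => rfl
  apply Set.Subset.antisymm
  · intro z hz
    induction hz using Algebra.adjoin_induction with
    | mem z hz =>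
      rw [Set.mem_singleton_iff] at hz
      rw [hz]
      exact Subfield.self_mem_integralAdjoin _ x
    | algebraMap a =>
      refine Subfield.unitBall_subset_integralAdjoin _ x ?_
      rw [← image_integers_eq_unitBall (p := p)]
      exact ⟨a, a.2, rfl⟩
    | add y z _ _ hy hz => exact add_mem (S := Subring K) hy hz
    | mul y z _ _ hy hz => exact mul_mem (S := Subring K) hy hz
  · have : (algebraMap F K).fieldRange.integralAdjoin x ≤
        (Algebra.adjoin (integers p F) {x}).toSubring := by
      refine Subfield.integralAdjoin_le (Algebra.subset_adjoin rfl) fun a ha => ?_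
      rw [← image_integers_eq_unitBall (p := p)] at ha
      obtain ⟨b, hb, rfl⟩ := ha
      exact (Algebra.adjoin (integers p F) {x}).algebraMap_mem ⟨b, hb⟩
    exact this

theorem finrank_fieldRange :
    Module.finrank (algebraMap F K).fieldRange K = Module.finrank F K :=
  (Algebra.finrank_eq_of_equiv_equiv (algebraMap F K).rangeRestrictFieldEquiv (RingEquiv.refl K)
    (by ext; rfl)).symm

variable [NormedAlgebra ℚ_[p] K]

theorem card_residueSubring_fieldRange :
    Nat.card ((algebraMap F K).fieldRange.residueSubring p) = residueCard p F := by
  have hloc : IsLocalHom (integersMap p F K) := ⟨fun a ha => by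
    rw [isUnit_integers_iff] at ha ⊢
    exact (norm_algebraMap' K (a : F)).symm.trans ha⟩
  set f := IsLocalRing.ResidueField.map (integersMap p F K)
  have hrange : ((algebraMap F K).fieldRange.residueSubring p : Set _) = Set.range f := by
    ext c
    constructor
    · rintro ⟨a, ⟨y, hy⟩, rfl⟩
      have hy' : algebraMap F K y = (a : K) := hy
      have hy1 : ‖y‖ ≤ 1 := by
        rw [← norm_algebraMap' K y, hy']
        exact (mem_integers p).1 a.2
      refine ⟨IsLocalRing.residue _ ⟨y, (mem_integers p).2 hy1⟩, ?_⟩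
      rw [IsLocalRing.ResidueField.map_residue]
      congr 1
      exact Subtype.ext hy'
    · rintro ⟨c, rfl⟩
      obtain ⟨a, rfl⟩ := IsLocalRing.residue_surjective c
      rw [IsLocalRing.ResidueField.map_residue]
      exact ⟨_, ⟨a, rfl⟩, rfl⟩
  rw [residueCard]
  refine (Nat.card_congr (Equiv.ofInjective f f.injective)).symm ▸ ?_
  exact Nat.card_congr (Equiv.setCongr hrange)

variable [FiniteDimensional ℚ_[p] K]

/-- If no element of `F` had the maximal norm `‖ϖ‖`, then `𝔪_F` would lie in the ideal `‖x‖ < ‖ϖ‖`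
of `𝒪_K`. So would `𝔪_F 𝒪_K = 𝔪_K`, which contains `ϖ`. -/
theorem IsUnramified.exists_isMaximalNormLTOne (h : IsUnramified p F K) :
    ∃ ϖ : F, IsMaximalNormLTOne (algebraMap F K ϖ) := by
  have := isUltrametricDist p K
  obtain ⟨ϖ, hϖ⟩ := PAdicField.exists_isMaximalNormLTOne p K
  by_contra! hne
  have hlt : ∀ y : F, ‖y‖ < 1 → ‖y‖ < ‖ϖ‖ := by
    intro y hy
    by_contra! hle
    refine hne y ⟨fun h0 => ?_, by rwa [norm_algebraMap'], fun x hx => ?_⟩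
    · rw [map_eq_zero] at h0
      rw [h0, norm_zero] at hle
      exact hϖ.norm_pos.not_ge hle
    · rw [norm_algebraMap']
      exact (hϖ.norm_le x hx).trans hle
  set J : Ideal (integers p K) :=
    { carrier := {x | ‖(x : K)‖ < ‖ϖ‖}
      add_mem' := fun {a b} ha hb =>
        (IsUltrametricDist.norm_add_le_max (a : K) b).trans_lt (max_lt ha hb)
      zero_mem' := by simpa using hϖ.ne_zero
      smul_mem' := fun a b hb => by
        change ‖(a : K) * b‖ < ‖ϖ‖
        rw [norm_mul]
        exact (mul_le_of_le_one_left (norm_nonneg _) ((mem_integers p).1 a.2)).trans_lt hb }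
  have hJ : IsLocalRing.maximalIdeal (integers p K) ≤ J := by
    rw [← show _ = IsLocalRing.maximalIdeal (integers p K) from h, Ideal.map_le_iff_le_comap]
    intro a ha
    change ‖algebraMap F K a‖ < ‖ϖ‖
    rw [norm_algebraMap']
    exact hlt a (mem_maximalIdeal_iff.1 ha)
  have hmem : (⟨ϖ, (mem_integers p).2 hϖ.norm_lt_one.le⟩ : integers p K) ∈
      IsLocalRing.maximalIdeal (integers p K) := mem_maximalIdeal_iff.2 hϖ.norm_lt_one
  exact lt_irrefl ‖ϖ‖ (hJ hmem)

variable (p) in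
theorem isClosedFiniteWith_fieldRange [FiniteDimensional ℚ_[p] F] [IsScalarTower ℚ_[p] F K]
    (ϖ : F) : (algebraMap F K).fieldRange.IsClosedFiniteWith (algebraMap F K ϖ) := by
  have := properSpace p F
  refine ⟨?_, ⟨ϖ, rfl⟩, ?_⟩
  · have hiso : Isometry (algebraMap F K) := algebraMap_isometry F K
    exact hiso.isClosedEmbedding.isClosed_range
  · have : FiniteDimensional F K := Module.Finite.of_restrictScalars_finite ℚ_[p] F K
    refine FiniteDimensional.of_finrank_pos ?_
    rw [finrank_fieldRange]
    exact Module.finrank_pos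

end PAdicField

theorem lemma4p5 (p : ℕ) [Fact p.Prime] (F K : Type*)
    [NormedField F] [NormedAlgebra ℚ_[p] F] [FiniteDimensional ℚ_[p] F]
    [NormedField K] [NormedAlgebra ℚ_[p] K] [FiniteDimensional ℚ_[p] K]
    [NormedAlgebra F K] [IsScalarTower ℚ_[p] F K]
    [MeasurableSpace K] [BorelSpace K]
    (hunr : PAdicField.IsUnramified p F K)
    (n : ℕ) (hn : Module.finrank F K = n)
    (q : ℕ) (hq : PAdicField.residueCard p F = q)
    (r : ℂ) (hr : 0 < r.re) :
    IntegrableOn (fun x : K => (PAdicField.phi p F K x : ℂ) ^ r)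
      (PAdicField.integers p K : Set K) (PAdicField.haar p K) ∧
    ∫ x in (PAdicField.integers p K : Set K), (PAdicField.phi p F K x : ℂ) ^ r
        ∂(PAdicField.haar p K) =
      dFunction n (q : ℂ) ((q : ℂ) ^ (-((n : ℂ) * r) / 2)) := by
  obtain ⟨ϖ, hϖ⟩ := hunr.exists_isMaximalNormLTOne
  have hL := PAdicField.isClosedFiniteWith_fieldRange p (F := F) (K := K) ϖ
  have hphi : ∀ x : K, PAdicField.phi p F K x = (algebraMap F K).fieldRange.adjoinVolume p x :=
    fun x => by rw [PAdicField.phi, Subfield.adjoinVolume, PAdicField.coe_adjoin_integers]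
  have hQ := Subfield.card_residueSubring_pow_finrank (p := p) hϖ hL
  have hI := Subfield.zetaIntegral_eq_dFunction (p := p) hϖ hr n _ hL
    (PAdicField.finrank_fieldRange.trans hn)
  -- Here `Q = q ^ n` turns `Q ^ (-r/2)` into `q ^ (-n r/2)`.
  rw [← hQ, PAdicField.card_residueSubring_fieldRange, PAdicField.finrank_fieldRange, hn, hq,
    natCast_pow_cpow] at hI
  simp only [hphi]
  refine ⟨Subfield.integrableOn_adjoinVolume_cpow hϖ hL hr, ?_⟩
  rw [show -((n : ℂ) * r) / 2 = n * (-r / 2) by ring, ← hI, Subfield.zetaIntegral]
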